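/- Let $\mathbb{Z}(2)=\{0,1\}$ be the group of residue classes modulo $2$, let $X=\mathbb{R}\times\mathbb{Z}(2)$, and for a probability distribution $\mu$ on $X$ let $$\hat\mu(s,l)=\int_X e^{its}(-1)^{kl}\,d\mu(t,k),\qquad s\in\mathbb{R},\ l\in\mathbb{Z}(2),$$ be its characteristic function. Gaussian distributions on $\mathbb{R}$ are understood to include the degenerate ones (point masses). Distributions on $\mathbb{R}$ and on $\mathbb{Z}(2)$ are regarded as distributions on $X$ concentrated on $\mathbb{R}\times\{0\}$ and $\{0\}\times\mathbb{Z}(2)$ respectively, and $m_{\mathbb{Z}(2)}$ is the Haar (uniform) distribution on $\mathbb{Z}(2)$. Let $\Lambda$ be the class of probability distributions $\mu$ on $X$ whose marginal $E\mapsto\mu(E\times\mathbb{Z}(2))$ on $\mathbb{R}$ is Gaussian. Let $\Theta$ be the class of probability distributions $\mu$ on $X$ such that, for some real $\sigma,\sigma'\ge 0$ and $\beta,\beta',\kappa\in\mathbb{R}$, $$\hat\mu(s,0)=\exp\{-\sigma s^2+i\beta s\},\qquad \hat\mu(s,1)=\kappa\exp\{-\sigma' s^2+i\beta' s\},\qquad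 s\in\mathbb{R},$$ where either $0<\sigma'<\sigma$ and $0<|\kappa|\le\sqrt{\sigma'/\sigma}\,\exp\left\{-\frac{(\beta-\beta')^2}{4(\sigma-\sigma')}\right\}$, or $\sigma=\sigma'$, $\beta=\beta'$ and $|\kappa|\le 1$. **Theorem 2.1.** Let $n\ge 2$, and let $a_j,b_j$ ($j=1,\dots,n$) be topological automorphisms of the group $X$ such that the endomorphism $b_ia_i^{-1}+b_ja_j^{-1}$ of $X$ is nonzero for all $i,j$. Let $\xi_1,\dots,\xi_n$ be independent random variables with values in $X$ and distributions $\mu_1,\dots,\mu_n$. Assume that the conditional distribution of the linear form $L_2=b_1\xi_1+\dots+b_n\xi_n$ given $L_1=a_1\xi_1+\dots+a_n\xi_n$ is symmetric, i.e. for almost every value of $L_1$ it is invariant under $x\mapsto -x$. Then exactly one of the following two cases holds. 1. All $\mu_j$ belong to $\Lambda$, and at least one of them is of the form $\mu_j=\gamma_j*m_{\mathbb{Z}(2)}$ with $\gamma_j$ a Gaussian distribution on $\mathbb{R}$. 2. All $\mu_j$ belong to $\Theta$, and their characteristic functions do not vanish at any point. -/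

import Mathlib

open MeasureTheory ProbabilityTheory

namespace HeydeRZ2

/-- The locally compact Abelian group `X = ℝ × ℤ(2)`, with the product of the usual topology of `ℝ`
and the discrete topology of `ℤ(2)`, and with its Borel σ-algebra. -/
abbrev X : Type := ℝ × ZMod 2

/-- The value `(x, y) = exp(i t s) (-1)^(k l)` of the character `y = (s, l)` at `x = (t, k)`; the
character group of `ℝ × ℤ(2)` is identified with `ℝ × ℤ(2)` in this way. -/
noncomputable def pairing (x : X) (s : ℝ) (l : ZMod 2) : ℂ :=
  Complex.exp (Complex.I * (x.1 : ℂ) * (s : ℂ)) * (-1 : ℂ) ^ (x.2.val * l.val)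

/-- The characteristic function `μ̂(s, l) = ∫ (x, (s, l)) dμ(x)` of a distribution on `X`. -/
noncomputable def charFn (μ : Measure X) (s : ℝ) (l : ZMod 2) : ℂ :=
  ∫ x, pairing x s l ∂μ

/-- `Γ(ℝ)`: the Gaussian distributions on the real line; `gaussianReal m 0` is the degenerate
distribution at `m`, so degenerate distributions are included. -/
def IsGaussianLaw (γ : Measure ℝ) : Prop :=
  ∃ (m : ℝ) (v : NNReal), γ = gaussianReal m v

/-- The class `Λ`: the `ℝ`-marginal `E ↦ μ(E × ℤ(2))` is Gaussian, possibly degenerate. -/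
def InLambda (μ : Measure X) : Prop :=
  IsGaussianLaw (μ.map Prod.fst)

/-- The class `Θ`. -/
def InTheta (μ : Measure X) : Prop :=
  ∃ σ σ' β β' κ : ℝ, 0 ≤ σ ∧ 0 ≤ σ' ∧
    (∀ s : ℝ, charFn μ s 0 =
      Complex.exp (-(σ : ℂ) * (s : ℂ) ^ 2 + Complex.I * (β : ℂ) * (s : ℂ))) ∧
    (∀ s : ℝ, charFn μ s 1 =
      (κ : ℂ) * Complex.exp (-(σ' : ℂ) * (s : ℂ) ^ 2 + Complex.I * (β' : ℂ) * (s : ℂ))) ∧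
    ((0 < σ' ∧ σ' < σ ∧ 0 < |κ| ∧
        |κ| ≤ Real.sqrt (σ' / σ) * Real.exp (-((β - β') ^ 2 / (4 * (σ - σ'))))) ∨
      (σ = σ' ∧ β = β' ∧ |κ| ≤ 1))

/-- The Haar distribution `m_{ℤ(2)}` of the group `ℤ(2)`: mass `1/2` at each of its two points. -/
noncomputable def haarZ2 : Measure (ZMod 2) :=
  (2 : ENNReal)⁻¹ • (Measure.dirac 0 + Measure.dirac 1)

instance : IsProbabilityMeasure haarZ2 :=
  ⟨by simp [haarZ2, ENNReal.inv_two_add_inv_two]⟩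

/-- `haarZ2` is translation invariant, so it is the Haar distribution. -/
instance : haarZ2.IsAddLeftInvariant := by
  refine ⟨fun g => ?_⟩
  have h1 : (1 : ZMod 2) + 1 = 0 := by decide
  have h2 : g = 0 ∨ g = 1 := by revert g; decide
  rcases h2 with rfl | rfl
  · simp
  · rw [haarZ2, Measure.map_smul, Measure.map_add _ _ (by fun_prop), Measure.map_dirac' (by fun_prop),
      Measure.map_dirac' (by fun_prop), h1, add_zero, add_comm]

/-- A distribution on `ℝ`, regarded as a distribution on `X` concentrated at `ℝ × {0}`. -/
noncomputable def embReal (γ : Measure ℝ) : Measure X :=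
  γ.map (fun t => (t, (0 : ZMod 2)))

/-- A distribution on `ℤ(2)`, regarded as a distribution on `X` concentrated at `{0} × ℤ(2)`. -/
noncomputable def embZ2 (ω : Measure (ZMod 2)) : Measure X :=
  ω.map (fun k => ((0 : ℝ), k))

/-- The conditional distribution of the `X`-valued random variable `L₂` given `L₁` is symmetric:
for almost every value `x` of `L₁`, the regular conditional distribution of `L₂` given `L₁ = x` is
invariant under `z ↦ -z`. -/
def CondSymmetric {Ω : Type*} [MeasurableSpace Ω] (P : Measure Ω) [IsFiniteMeasure P]
    (L₂ L₁ : Ω → X) : Prop :=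
  ∀ᵐ x ∂(P.map L₁), (condDistrib L₂ L₁ P x).map (fun z => -z) = condDistrib L₂ L₁ P x

end HeydeRZ2

/-!
Topological automorphisms of `ℝ × ℤ(2)` are dilations `(t, k) ↦ (α t, k)` with `α ≠ 0`, so with
`c j = β j / α j` the hypothesis on `b i (a i)⁻¹ + b j (a j)⁻¹` says that `c i + c j ≠ 0` for all
`i, j`. Conditional symmetry means that `(L₁, L₂)` and `(L₁, -L₂)` are identically distributed;
by independence this becomes, for each `l` separately, Heyde's functional equation
`∏ f j (s + c j * t) = ∏ f j (s - c j * t)` for `f j s = charFn (μ j) (α j * s) l`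
(`charFn_functional_equation`).

For `l = 0` the functions are characteristic functions on the line, and Heyde's theorem
(`isGaussianLaw_of_heyde`) shows that all real marginals are Gaussian. Its proof symmetrizes and takes
logarithms near the origin; the resulting linear functional equation has only polynomial solutions
(`eventually_eq_polynomial_of_sum_eq_zero`). Hence products of the characteristic functions of
the symmetrized marginals are exponentials of polynomials near the origin, which forces finite
exponential moments (`integrable_exp_of_charFun_eq_entire`), and the theorems of Marcinkiewicz and
Cramér, proved together in `isGaussianLaw_of_charFun_mul_eq_exp`, apply.

For `l = 1` the function `charFn (μ j) s 1` is the Fourier transform of the difference of the two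
slices of `μ j`, which are dominated by the Gaussian marginal; it therefore extends to an entire
function of order at most two. If one of these functions vanishes identically, the two slices of that
`μ j` coincide, and `μ j` is a convolution with the Haar distribution. Otherwise the functional
equation holds in `ℂ`, and a zero of one factor would make the other side vanish on a complex line,
which is impossible since `c i + c j ≠ 0` (`entire_heyde_ne_zero`). A zero-free entire function of
order at most two is the exponential of a quadratic polynomial, so
`charFn (μ j) s 1 = κ exp (-σ' s² + i β' s)`. Then `|κ|` times a Gaussian distribution is dominated by
the marginal, and comparing densities (`gaussianReal_domination`) yields exactly the inequalities
defining `Θ`. The two cases exclude each other because `charFn μ s 1` vanishes identically in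
the Haar case.
-/

namespace HeydeRZ2

open Filter Topology Complex

/-! ### Entire functions of finite order -/

/-- Liouville's theorem for one-sided polynomial growth: an entire function whose real part grows
at most like `‖z‖ ^ N` is a polynomial of degree at most `N`. -/
theorem exists_polynomial_of_re_le {f : ℂ → ℂ} (hf : Differentiable ℂ f) {C : ℝ} {N : ℕ}
    (hC : 0 < C) (hb : ∀ z, (f z).re ≤ C * (1 + ‖z‖) ^ N) :
    ∃ p : Polynomial ℂ, p.natDegree ≤ N ∧ ∀ z, f z = p.eval z := by
  set K : ℝ := 2 * (C * 3 ^ N) + 3 * ‖f 0‖ with hK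
  have hK0 : 0 ≤ K := by positivity
  -- Borel–Carathéodory on the disc of radius `2 * R` turns the bound on the real part into one
  -- on the norm
  have hnorm : ∀ R : ℝ, 1 ≤ R → ∀ z ∈ Metric.sphere (0 : ℂ) R, ‖f z‖ ≤ K * R ^ N := by
    intro R hR z hz
    have hz' : ‖z‖ = R := by simpa using hz
    have hM : 0 < C * (3 * R) ^ N := by positivity
    have key := borelCaratheodory (f := f) (R := 2 * R) (z := z) hM hf.differentiableOn
      (fun w hw => by
        refine (hb w).trans ?_
        have hw' : ‖w‖ < 2 * R := by simpa using hw
        gcongr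
        linarith) (by linarith) (by simp [hz']; linarith)
    rw [hz'] at key
    have e1 : 2 * R - R = R := by ring
    have e2 : 2 * R + R = 3 * R := by ring
    have hR0 : R ≠ 0 := by positivity
    rw [e1, e2, mul_div_assoc, div_self hR0, mul_one, mul_div_assoc, mul_div_assoc, div_self hR0,
      mul_pow] at key
    have : 1 ≤ R ^ N := one_le_pow₀ hR
    have h0 := norm_nonneg (f 0)
    rw [hK]
    nlinarith
  have hzero : ∀ n, N < n → iteratedDeriv n f 0 = 0 := by
    intro n hn
    have hlim : Tendsto (fun R : ℝ => n.factorial * K * R⁻¹) atTop (𝓝 0) := by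
      simpa using tendsto_inv_atTop_zero.const_mul ((n.factorial : ℝ) * K)
    have hle : ∀ᶠ R : ℝ in atTop, ‖iteratedDeriv n f 0‖ ≤ n.factorial * K * R⁻¹ := by
      filter_upwards [eventually_ge_atTop 1] with R hR
      have h1 := norm_iteratedDeriv_le_of_forall_mem_sphere_norm_le n (by linarith : 0 < R)
        hf.diffContOnCl (hnorm R hR)
      refine h1.trans ?_
      have h2 : R ^ N * R ≤ R ^ n := by
        rw [← pow_succ]; exact pow_le_pow_right₀ hR hn
      have hR0 : 0 < R := by linarith
      rw [← div_eq_mul_inv, div_le_div_iff₀ (by positivity) (by positivity)]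
      have := mul_le_mul_of_nonneg_left h2 (by positivity : 0 ≤ n.factorial * K)
      linarith
    exact norm_le_zero_iff.1 (ge_of_tendsto hlim hle)
  refine ⟨∑ n ∈ Finset.range (N + 1),
    Polynomial.monomial n ((n.factorial : ℂ)⁻¹ * iteratedDeriv n f 0), ?_, fun z => ?_⟩
  · refine Polynomial.natDegree_sum_le_of_forall_le _ _ fun i hi => ?_
    exact (Polynomial.natDegree_monomial_le _).trans (Nat.lt_succ_iff.1 (Finset.mem_range.1 hi))
  · rw [← taylorSeries_eq_of_entire' 0 z hf, tsum_eq_sum (s := Finset.range (N + 1))]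
    · simp [Polynomial.eval_finsetSum]
    · intro n hn
      rw [hzero n (by simpa using hn)]
      simp

/-- A zero-free entire function of finite order is the exponential of a polynomial (the zero-free
case of Hadamard's factorization theorem). -/
theorem exists_eq_exp_polynomial {F : ℂ → ℂ} (hF : Differentiable ℂ F) (hF0 : ∀ z, F z ≠ 0)
    {C : ℝ} {N : ℕ} (hb : ∀ z, ‖F z‖ ≤ Real.exp (C * (1 + ‖z‖) ^ N)) :
    ∃ p : Polynomial ℂ, p.natDegree ≤ N ∧ ∀ z, F z = exp (p.eval z) := by
  have hF' : Differentiable ℂ (deriv F) := by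
    intro z
    exact (hF.analyticAt z).deriv.differentiableAt
  obtain ⟨L, hL⟩ := Differentiable.isExactOn_univ (f := fun z => deriv F z / F z)
    (hF'.div hF hF0)
  have hconst : ∀ z, F z * exp (-L z) = F 0 * exp (-L 0) := by
    have hd : ∀ z, HasDerivAt (fun z => F z * exp (-L z)) 0 z := by
      intro z
      have h := (hF z).hasDerivAt.mul ((hL z (Set.mem_univ z)).neg.cexp)
      refine h.congr_deriv ?_
      have := hF0 z
      field_simp
      ring
    intro z
    exact is_const_of_deriv_eq_zero (fun z => (hd z).differentiableAt) (fun z => (hd z).deriv) z 0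
  set g : ℂ → ℂ := fun z => L z + (log (F 0) - L 0) with hg
  have hFg : ∀ z, F z = exp (g z) := by
    intro z
    rw [hg]
    simp only
    rw [exp_add, exp_sub, exp_log (hF0 0)]
    have := hconst z
    rw [exp_neg, exp_neg] at this
    field_simp at this ⊢
    linear_combination this
  have hgd : Differentiable ℂ g := fun z =>
    ((hL z (Set.mem_univ z)).differentiableAt).add_const _
  obtain ⟨p, hp, hpe⟩ := exists_polynomial_of_re_le hgd (C := |C| + 1) (N := N) (by positivity)
    (fun z => by
      have h := hb z
      rw [hFg z, norm_exp, Real.exp_le_exp] at h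
      refine h.trans ?_
      gcongr
      linarith [le_abs_self C])
  exact ⟨p, hp, fun z => by rw [hFg z, hpe z]⟩

theorem tendsto_polynomial_eval_div_pow (q : Polynomial ℂ) (w : ℂ) :
    Tendsto (fun r : ℝ => q.eval ((r : ℂ) * w) / (r : ℂ) ^ q.natDegree) atTop
      (𝓝 (q.leadingCoeff * w ^ q.natDegree)) := by
  have hterm : ∀ i ∈ Finset.range q.natDegree,
      Tendsto (fun r : ℝ => q.coeff i * ((r : ℂ) * w) ^ i / (r : ℂ) ^ q.natDegree) atTop (𝓝 0) := by
    intro i hi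
    have hi' := Finset.mem_range.1 hi
    have h1 : Tendsto (fun r : ℝ => (r ^ (q.natDegree - i))⁻¹) atTop (𝓝 0) :=
      (tendsto_pow_atTop (by omega)).inv_tendsto_atTop
    have h2 : Tendsto (fun r : ℝ => (((r ^ (q.natDegree - i))⁻¹ : ℝ) : ℂ)) atTop (𝓝 0) :=
      (continuous_ofReal.tendsto' 0 0 (by simp)).comp h1
    have h3 := h2.const_mul (q.coeff i * w ^ i)
    rw [mul_zero] at h3
    refine h3.congr' ?_
    filter_upwards [eventually_gt_atTop 0] with r hr
    have hr' : (r : ℂ) ≠ 0 := by exact_mod_cast hr.ne'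
    have : (r : ℂ) ^ q.natDegree = (r : ℂ) ^ i * (r : ℂ) ^ (q.natDegree - i) := by
      rw [← pow_add]; congr 1; omega
    rw [this, mul_pow]
    push_cast
    field_simp
  have hsum := tendsto_finsetSum (Finset.range q.natDegree) hterm
  rw [Finset.sum_const_zero] at hsum
  have hlead : Tendsto (fun _ : ℝ => q.leadingCoeff * w ^ q.natDegree) atTop
    (𝓝 (q.leadingCoeff * w ^ q.natDegree)) := tendsto_const_nhds
  have := hsum.add hlead
  rw [zero_add] at this
  refine this.congr' ?_
  filter_upwards [eventually_gt_atTop 0] with r hr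
  have hr' : (r : ℂ) ≠ 0 := by exact_mod_cast hr.ne'
  rw [Polynomial.eval_eq_sum_range, Finset.sum_range_succ, add_div, Finset.sum_div, mul_pow,
    Polynomial.leadingCoeff]
  congr 1
  field_simp

/-- The algebraic core of Marcinkiewicz's theorem: the ridge property
`Re q (x + i y) ≤ Re q x` forces `q` to have degree at most two. Comparing leading terms along a
ray in a direction `w` with `c * w ^ n > 0` shows that `w` is real; for `n ≥ 3` two adjacent such
directions cannot both be real. -/
theorem natDegree_le_two_of_ridge (q : Polynomial ℂ)
    (hq : ∀ z : ℂ, (q.eval z).re ≤ (q.eval (z.re : ℂ)).re) : q.natDegree ≤ 2 := by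
  by_contra hn
  push Not at hn
  set n := q.natDegree with hnn
  set c := q.leadingCoeff with hc
  have hc0 : c ≠ 0 := by
    rw [hc, Polynomial.leadingCoeff_ne_zero]
    rintro rfl
    simp at hnn
    omega
  have key : ∀ w : ℂ, ‖w‖ = 1 → c * w ^ n = (‖c‖ : ℂ) → w.im = 0 := by
    intro w hw hcw
    have h1 : Tendsto (fun r : ℝ => (q.eval ((r : ℂ) * w) / (r : ℂ) ^ n).re) atTop
        (𝓝 (c * w ^ n).re) := (continuous_re.tendsto _).comp (tendsto_polynomial_eval_div_pow q w)
    have h2 : Tendsto (fun r : ℝ => (q.eval ((r : ℂ) * (w.re : ℂ)) / (r : ℂ) ^ n).re) atTop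
        (𝓝 (c * (w.re : ℂ) ^ n).re) :=
      (continuous_re.tendsto _).comp (tendsto_polynomial_eval_div_pow q w.re)
    have h3 : (c * w ^ n).re ≤ (c * (w.re : ℂ) ^ n).re := by
      refine le_of_tendsto_of_tendsto h1 h2 ?_
      filter_upwards [eventually_gt_atTop 0] with r hr
      have := hq ((r : ℂ) * w)
      rw [re_ofReal_mul, ofReal_mul] at this
      rw [← ofReal_pow, div_ofReal_re, div_ofReal_re]
      gcongr
    rw [hcw, ofReal_re] at h3
    have h4 : (c * (w.re : ℂ) ^ n).re ≤ ‖c‖ * |w.re| ^ n := by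
      refine (re_le_norm _).trans ?_
      rw [norm_mul, norm_pow, norm_real, Real.norm_eq_abs]
    have h5 : 1 ≤ |w.re| ^ n := by
      have hcpos : 0 < ‖c‖ := norm_pos_iff.2 hc0
      have := h3.trans h4
      exact le_of_mul_le_mul_left (by simpa using this) hcpos
    have h6 : 1 ≤ |w.re| := by
      by_contra hlt
      push Not at hlt
      have := pow_lt_one₀ (abs_nonneg w.re) hlt (by omega : n ≠ 0)
      linarith
    have h7 : w.re ^ 2 + w.im ^ 2 = 1 := by
      have := Complex.sq_norm w
      rw [hw, normSq_apply] at this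
      nlinarith
    have h8 : 1 ≤ w.re ^ 2 := by
      rw [← sq_abs]; nlinarith
    nlinarith
  obtain ⟨w, hw⟩ := IsAlgClosed.exists_pow_nat_eq ((‖c‖ : ℂ) / c) (by omega : 0 < n)
  have hwn : ‖w‖ = 1 := by
    have h : ‖w‖ ^ n = 1 := by
      rw [← norm_pow, hw, norm_div, norm_real, norm_norm, div_self (norm_ne_zero_iff.2 hc0)]
    exact (pow_eq_one_iff_of_nonneg (norm_nonneg w) (by omega)).1 h
  have hcw : c * w ^ n = (‖c‖ : ℂ) := by
    rw [hw]; field_simp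
  have hn0 : (n : ℂ) ≠ 0 := by exact_mod_cast (by omega : n ≠ 0)
  set θ : ℝ := 2 * Real.pi / n with hθ
  have hζn : exp ((θ : ℂ) * I) ^ n = 1 := by
    rw [← exp_nat_mul, hθ]
    push_cast
    rw [show (n : ℂ) * (2 * Real.pi / n * I) = 2 * Real.pi * I by field_simp]
    exact exp_two_pi_mul_I
  have hw0 := key w hwn hcw
  have hwz := key (w * exp ((θ : ℂ) * I)) (by rw [norm_mul, hwn, norm_exp_ofReal_mul_I, one_mul])
    (by rw [mul_pow, hζn, mul_one, hcw])
  rw [mul_im, hw0, zero_mul, add_zero, exp_ofReal_mul_I_im] at hwz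
  have hsin : 0 < Real.sin θ := by
    have hn3 : (3 : ℝ) ≤ n := by exact_mod_cast hn
    apply Real.sin_pos_of_pos_of_lt_pi
    · rw [hθ]; positivity
    · rw [hθ, div_lt_iff₀ (by linarith)]
      nlinarith [Real.pi_pos]
  rcases mul_eq_zero.1 hwz with h | h
  · have : w = 0 := Complex.ext h hw0
    rw [this] at hwn
    simp at hwn
  · exact hsin.ne' h

theorem entire_eq_of_eq_ofReal {f g : ℂ → ℂ} (hf : Differentiable ℂ f) (hg : Differentiable ℂ g)
    {δ : ℝ} (hδ : 0 < δ) (h : ∀ s : ℝ, |s| < δ → f s = g s) : f = g := by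
  refine AnalyticOnNhd.eq_of_frequently_eq (𝕜 := ℂ) (z₀ := 0)
    (fun z _ => hf.analyticAt z) (fun z _ => hg.analyticAt z) ?_
  have ht : Tendsto (fun s : ℝ => (s : ℂ)) (𝓝[>] (0 : ℝ)) (𝓝[≠] (0 : ℂ)) := by
    refine tendsto_nhdsWithin_iff.2 ⟨?_, ?_⟩
    · exact ((continuous_ofReal.tendsto' 0 0 (by simp)).mono_left nhdsWithin_le_nhds)
    · filter_upwards [self_mem_nhdsWithin] with s hs
      have : s ≠ 0 := (Set.mem_Ioi.1 hs).ne'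
      simpa using this
  refine ht.frequently (Eventually.frequently ?_)
  filter_upwards [Ioo_mem_nhdsGT hδ] with s hs
  exact h s (by rw [abs_of_pos hs.1]; exact hs.2)

/-- An entire function that is not identically zero has isolated zeros. -/
theorem eventually_ne_zero_of_entire {f : ℂ → ℂ} (hf : Differentiable ℂ f) (h : ∃ z, f z ≠ 0)
    (z₀ : ℂ) : ∀ᶠ z in 𝓝[≠] z₀, f z ≠ 0 := by
  rcases (hf.analyticAt z₀).eventually_eq_zero_or_eventually_ne_zero with h0 | h0
  · obtain ⟨z, hz⟩ := h
    have := AnalyticOnNhd.eq_of_eventuallyEq (𝕜 := ℂ) (z₀ := z₀) (f := f) (g := fun _ => 0)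
      (fun z _ => hf.analyticAt z) (fun z _ => analyticAt_const) h0
    exact absurd (congrFun this z) hz
  · exact h0

/-- Entire solutions of the Heyde equation have no zeros: along the line `z + c j * w = a`, where
`a` is a zero of the `j`-th function, the right-hand side would be a vanishing product of entire
functions of `w`, none of which is identically zero because `c j + c k ≠ 0`. -/
theorem entire_heyde_ne_zero {ι : Type*} [Fintype ι] {H : ι → ℂ → ℂ} {c : ι → ℝ}
    (hH : ∀ j, Differentiable ℂ (H j)) (hH0 : ∀ j, ∃ z, H j z ≠ 0)
    (hc : ∀ i j, c i + c j ≠ 0)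
    (heq : ∀ s t : ℝ, ∏ j, H j ((s : ℂ) + c j * t) = ∏ j, H j ((s : ℂ) - c j * t))
    (j : ι) (z : ℂ) : H j z ≠ 0 := by
  have h1 : ∀ (t : ℝ) (z : ℂ), ∏ j, H j (z + c j * t) = ∏ j, H j (z - c j * t) := by
    intro t z
    refine congrFun (entire_eq_of_eq_ofReal (f := fun z => ∏ j, H j (z + c j * t))
      (g := fun z => ∏ j, H j (z - c j * t)) ?_ ?_ one_pos fun s _ => heq s t) z
    · exact Differentiable.fun_finsetProd fun j _ =>
        (hH j).comp (by fun_prop : Differentiable ℂ fun z : ℂ => z + c j * t)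
    · exact Differentiable.fun_finsetProd fun j _ =>
        (hH j).comp (by fun_prop : Differentiable ℂ fun z : ℂ => z - c j * t)
  -- the equation extends to complex arguments, one variable at a time
  have h2 : ∀ (w z : ℂ), ∏ j, H j (z + c j * w) = ∏ j, H j (z - c j * w) := by
    intro w z
    refine congrFun (entire_eq_of_eq_ofReal (f := fun w => ∏ j, H j (z + c j * w))
      (g := fun w => ∏ j, H j (z - c j * w)) ?_ ?_ one_pos fun t _ => h1 t z) w
    · exact Differentiable.fun_finsetProd fun j _ =>
        (hH j).comp (by fun_prop : Differentiable ℂ fun w : ℂ => z + c j * w)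
    · exact Differentiable.fun_finsetProd fun j _ =>
        (hH j).comp (by fun_prop : Differentiable ℂ fun w : ℂ => z - c j * w)
  intro hz
  -- on the line through the zero `z` of `H j`, each factor on the right has isolated zeros
  have hne : ∀ k, ∀ᶠ w in 𝓝[≠] (0 : ℂ), H k (z - c j * w - c k * w) ≠ 0 := by
    intro k
    have hck : ((c j : ℂ) + c k) ≠ 0 := by exact_mod_cast hc j k
    refine eventually_ne_zero_of_entire (f := fun w => H k (z - c j * w - c k * w))
      ((hH k).comp (by fun_prop : Differentiable ℂ fun w : ℂ => z - c j * w - c k * w)) ?_ 0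
    obtain ⟨y, hy⟩ := hH0 k
    refine ⟨(z - y) / (c j + c k), ?_⟩
    have : z - c j * ((z - y) / (c j + c k)) - c k * ((z - y) / (c j + c k)) = y := by
      field_simp
      ring
    simpa only [this] using hy
  obtain ⟨w, hw⟩ := (eventually_all.2 hne).exists
  have hR : ∏ k, H k (z - c j * w - c k * w) ≠ 0 := Finset.prod_ne_zero_iff.2 fun k _ => hw k
  apply hR
  rw [← h2 w (z - c j * w)]
  refine Finset.prod_eq_zero (Finset.mem_univ j) ?_
  rw [sub_add_cancel, hz]

/-- The coefficients are read off from the derivative of the constant function at `0` and `1`. -/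
theorem exp_quadratic_eq_one {a b : ℂ} (h : ∀ s : ℝ, exp (a * s + b * s ^ 2) = 1) :
    a = 0 ∧ b = 0 := by
  have hd : ∀ s : ℝ, a + 2 * b * s = 0 := by
    intro s
    have h1 : HasDerivAt (fun s : ℝ => exp (a * s + b * s ^ 2))
        (exp (a * s + b * s ^ 2) * (a + 2 * b * s)) s := by
      have hs : HasDerivAt (fun s : ℝ => (s : ℂ)) 1 s := ofRealCLM.hasDerivAt
      have := ((hs.const_mul a).add ((hs.pow 2).const_mul b)).cexp
      refine this.congr_deriv ?_
      simp only [Pi.pow_apply, Pi.add_apply]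
      push_cast
      ring
    have h2 : HasDerivAt (fun s : ℝ => exp (a * s + b * s ^ 2)) 0 s := by
      simp_rw [h]
      exact hasDerivAt_const s (1 : ℂ)
    have := h1.unique h2
    rwa [h s, one_mul] at this
  have h0 := hd 0
  have h1 := hd 1
  simp only [ofReal_zero, mul_zero, add_zero, ofReal_one, mul_one] at h0 h1
  refine ⟨h0, ?_⟩
  rw [h0, zero_add] at h1
  simpa using h1

/-- If `M = exp q` with `q` of degree at most two is real on the real axis and bounded on the
imaginary axis, then `s ↦ M (i s)` is a real multiple of a Gaussian characteristic function. -/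
theorem exists_gaussian_form {M : ℂ → ℂ} {q : Polynomial ℂ} (hq : q.natDegree ≤ 2)
    (hM : ∀ z, M z = exp (q.eval z)) (hreal : ∀ x : ℝ, (starRingEnd ℂ) (M x) = M x) {B : ℝ}
    (hB : ∀ s : ℝ, ‖M (s * I)‖ ≤ B) :
    ∃ κ σ β : ℝ, κ ≠ 0 ∧ 0 ≤ σ ∧ M 0 = κ ∧ ∀ s : ℝ, M (s * I) =
      (κ : ℂ) * exp (-(σ : ℂ) * (s : ℂ) ^ 2 + I * (β : ℂ) * (s : ℂ)) := by
  set q0 := q.coeff 0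
  set q1 := q.coeff 1
  set q2 := q.coeff 2
  have hM' : ∀ z, M z = M 0 * exp (q1 * z + q2 * z ^ 2) := by
    intro z
    have he : ∀ z, q.eval z = q0 + q1 * z + q2 * z ^ 2 := by
      intro z
      rw [Polynomial.eval_eq_sum_range' (n := 3) (by omega)]
      simp [Finset.sum_range_succ, q0, q1, q2]
    rw [hM, hM, he, he, ← exp_add]
    congr 1
    ring
  have hM0 : M 0 ≠ 0 := by rw [hM]; exact exp_ne_zero _
  have hre0 : (starRingEnd ℂ) (M 0) = M 0 := by simpa using hreal 0
  obtain ⟨h1, h2⟩ := exp_quadratic_eq_one (a := (starRingEnd ℂ) q1 - q1)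
    (b := (starRingEnd ℂ) q2 - q2) (fun s => by
      have h := hreal s
      rw [hM' s, map_mul, hre0, ← exp_conj] at h
      have h := mul_left_cancel₀ hM0 h
      simp only [map_add, map_mul, map_pow, conj_ofReal] at h
      rw [show ((starRingEnd ℂ) q1 - q1) * (s : ℂ) + ((starRingEnd ℂ) q2 - q2) * (s : ℂ) ^ 2
        = ((starRingEnd ℂ) q1 * s + (starRingEnd ℂ) q2 * (s : ℂ) ^ 2)
          - (q1 * s + q2 * (s : ℂ) ^ 2) by ring, exp_sub, h, div_self (exp_ne_zero _)])
  obtain ⟨β, hβ⟩ := conj_eq_iff_real.1 (sub_eq_zero.1 h1)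
  obtain ⟨σ, hσ⟩ := conj_eq_iff_real.1 (sub_eq_zero.1 h2)
  obtain ⟨κ, hκ⟩ := conj_eq_iff_real.1 hre0
  have hform : ∀ s : ℝ, M (s * I) =
      (κ : ℂ) * exp (-(σ : ℂ) * (s : ℂ) ^ 2 + I * (β : ℂ) * (s : ℂ)) := by
    intro s
    rw [hM', hκ, hβ, hσ]
    congr 2
    rw [mul_pow, I_sq]
    ring
  refine ⟨κ, σ, β, ?_, ?_, hκ, hform⟩
  · rintro rfl
    exact hM0 (by simpa using hκ)
  · by_contra hneg
    push Not at hneg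
    have hκ0 : 0 < |κ| := by
      rw [abs_pos]
      rintro rfl
      exact hM0 (by simpa using hκ)
    have hbd : ∀ s : ℝ, |κ| * Real.exp (-σ * s ^ 2) ≤ B := by
      intro s
      have := hB s
      rw [hform, norm_mul, norm_real, Real.norm_eq_abs, norm_exp] at this
      convert this using 3
      simp [← ofReal_pow]
    have hpos : 0 < B / |κ| + 1 := by
      have := (mul_pos hκ0 (Real.exp_pos _)).trans_le (hbd 0)
      positivity
    have h := hbd (Real.sqrt ((B / |κ| + 1) / (-σ)))
    rw [Real.sq_sqrt (div_nonneg hpos.le (by linarith)), mul_div_cancel₀ _ (by linarith)] at h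
    have h' := Real.add_one_le_exp (B / |κ| + 1)
    have h'' := mul_le_mul_of_nonneg_left h' hκ0.le
    have e : |κ| * (B / |κ| + 1 + 1) = B + 2 * |κ| := by field_simp; ring
    linarith

end HeydeRZ2

namespace HeydeRZ2

open Filter Topology
open scoped ContDiff Convolution

/-! ### A linear functional equation with continuous solutions -/

theorem exists_polynomial_of_iteratedDeriv_eq_zero {δ : ℝ} (N : ℕ) :
    ∀ {f : ℝ → ℝ}, ContDiff ℝ ∞ f → (∀ s, |s| < δ → iteratedDeriv N f s = 0) →
      ∃ p : Polynomial ℝ, p.degree < N ∧ ∀ s, |s| < δ → f s = p.eval s := by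
  induction N with
  | zero =>
    intro f _ h
    exact ⟨0, by simp, fun s hs => by simpa using h s hs⟩
  | succ N ih =>
    intro f hf h
    obtain ⟨p, hp, hpe⟩ := ih (f := deriv f) ((contDiff_infty_iff_deriv.1 hf).2) (fun s hs => by
      rw [← iteratedDeriv_succ']
      exact h s hs)
    set Q : Polynomial ℝ :=
      ∑ i ∈ Finset.range N, Polynomial.monomial (i + 1) (p.coeff i / (i + 1)) with hQ
    have hQd : Polynomial.derivative Q = p := by
      ext k
      have hk : ((k : ℝ) + 1) ≠ 0 := by positivity
      by_cases hkN : k < N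
      · simp [hQ, Polynomial.finsetSum_coeff,
          Polynomial.coeff_monomial, hkN, div_mul_cancel₀ _ hk]
      · have : p.coeff k = 0 := Polynomial.coeff_eq_zero_of_degree_lt
          (hp.trans_le (by exact_mod_cast not_lt.1 hkN))
        simp [hQ, Polynomial.finsetSum_coeff,
          Polynomial.coeff_monomial, hkN, this]
    have hQdeg : Q.degree < (N + 1 : ℕ) := by
      refine (Polynomial.degree_lt_iff_coeff_zero _ _).2 fun k hk => ?_
      simp only [hQ, Polynomial.finsetSum_coeff, Polynomial.coeff_monomial]
      refine Finset.sum_eq_zero fun i hi => if_neg ?_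
      have := Finset.mem_range.1 hi
      omega
    refine ⟨Q + Polynomial.C (f 0 - Q.eval 0), ?_, fun s hs => ?_⟩
    · refine (Polynomial.degree_add_le _ _).trans_lt (max_lt hQdeg ?_)
      exact Polynomial.degree_C_le.trans_lt (by exact_mod_cast Nat.succ_pos N)
    · have hδ : 0 < δ := (abs_nonneg s).trans_lt hs
      have hfd : Differentiable ℝ f := hf.differentiable (by simp)
      have key := IsOpen.is_const_of_deriv_eq_zero (𝕜 := ℝ) (f := fun x => f x - Q.eval x)
        (s := Metric.ball 0 δ) Metric.isOpen_ball (convex_ball 0 δ).isPreconnected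
        (fun x _ => ((hfd x).sub Q.differentiable.differentiableAt).differentiableWithinAt)
        (fun x hx => by
          have hx' : |x| < δ := by simpa using hx
          have := ((hfd x).hasDerivAt.sub (Q.hasDerivAt x)).deriv
          simp only [Pi.zero_apply]
          refine this.trans ?_
          rw [hQd, hpe x hx', sub_self])
        (x := s) (y := 0) (by simpa using hs) (by simpa using hδ)
      simp only [Polynomial.eval_add, Polynomial.eval_C]
      linarith

/-- Differentiating `∑ d, w d * Ψ d ^ (m) (s + d * t) = 0` in `s` and in `t`. -/
theorem sum_iteratedDeriv_succ_eq_zero {D : Finset ℝ} {Ψ : ℝ → ℝ → ℝ}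
    (hΨ : ∀ d ∈ D, ContDiff ℝ ∞ (Ψ d)) {δ : ℝ} {w : ℝ → ℝ} {m : ℕ}
    (h : ∀ s t : ℝ, |s| < δ → |t| < δ →
      ∑ d ∈ D, w d * iteratedDeriv m (Ψ d) (s + d * t) = 0) (s t : ℝ) (hs : |s| < δ)
    (ht : |t| < δ) :
    ∑ d ∈ D, w d * iteratedDeriv (m + 1) (Ψ d) (s + d * t) = 0 ∧
    ∑ d ∈ D, (w d * d) * iteratedDeriv (m + 1) (Ψ d) (s + d * t) = 0 := by
  have hder : ∀ d ∈ D, ∀ x, HasDerivAt (iteratedDeriv m (Ψ d)) (iteratedDeriv (m + 1) (Ψ d) x) x := by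
    intro d hd x
    rw [iteratedDeriv_succ]
    exact ((hΨ d hd).differentiable_iteratedDeriv m (by exact_mod_cast ENat.natCast_lt_top m)
      x).hasDerivAt
  have hev : ∀ x : ℝ, |x| < δ → ∀ᶠ y in 𝓝 x, |y| < δ := fun x hx =>
    continuous_abs.continuousAt.eventually_lt continuousAt_const hx
  constructor
  · have h1 : HasDerivAt (fun s => ∑ d ∈ D, w d * iteratedDeriv m (Ψ d) (s + d * t))
        (∑ d ∈ D, w d * iteratedDeriv (m + 1) (Ψ d) (s + d * t)) s :=
      HasDerivAt.fun_sum fun d hd => ((hder d hd _).comp_add_const s (d * t)).const_mul (w d)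
    have h2 : HasDerivAt (fun s => ∑ d ∈ D, w d * iteratedDeriv m (Ψ d) (s + d * t)) 0 s := by
      refine (hasDerivAt_const s (0 : ℝ)).congr_of_eventuallyEq ?_
      filter_upwards [hev s hs] with y hy
      exact h y t hy ht
    exact h1.unique h2
  · have h1 : HasDerivAt (fun t => ∑ d ∈ D, w d * iteratedDeriv m (Ψ d) (s + d * t))
        (∑ d ∈ D, (w d * d) * iteratedDeriv (m + 1) (Ψ d) (s + d * t)) t := by
      refine HasDerivAt.fun_sum fun d hd => ?_
      have hin : HasDerivAt (fun t => s + d * t) d t := by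
        simpa using ((hasDerivAt_id t).const_mul d).const_add s
      refine (((hder d hd _).comp t hin).const_mul (w d)).congr_deriv ?_
      ring
    have h2 : HasDerivAt (fun t => ∑ d ∈ D, w d * iteratedDeriv m (Ψ d) (s + d * t)) 0 t := by
      refine (hasDerivAt_const t (0 : ℝ)).congr_of_eventuallyEq ?_
      filter_upwards [hev t ht] with y hy
      exact h s y hs hy
    exact h1.unique h2

/-- For smooth functions, differentiating the equation `∑ d, Ψ d (s + d * t) = 0` gives a
Vandermonde system at `t = 0` for the derivatives of order `#D`. -/
theorem iteratedDeriv_eq_zero_of_sum_eq_zero {D : Finset ℝ} {Ψ : ℝ → ℝ → ℝ}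
    (hΨ : ∀ d ∈ D, ContDiff ℝ ∞ (Ψ d)) {δ : ℝ}
    (h : ∀ s t : ℝ, |s| < δ → |t| < δ → ∑ d ∈ D, Ψ d (s + d * t) = 0) {d₀ : ℝ} (hd₀ : d₀ ∈ D)
    {s : ℝ} (hs : |s| < δ) : iteratedDeriv D.card (Ψ d₀) s = 0 := by
  have hall : ∀ m i : ℕ, i ≤ m → ∀ s t : ℝ, |s| < δ → |t| < δ →
      ∑ d ∈ D, d ^ i * iteratedDeriv m (Ψ d) (s + d * t) = 0 := by
    intro m
    induction m with
    | zero =>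
      intro i hi s t hs ht
      obtain rfl : i = 0 := by omega
      simpa using h s t hs ht
    | succ m ih =>
      intro i hi s t hs ht
      rcases Nat.le_or_eq_of_le_succ hi with hi | rfl
      · exact (sum_iteratedDeriv_succ_eq_zero hΨ (ih i hi) s t hs ht).1
      · have := (sum_iteratedDeriv_succ_eq_zero hΨ (ih m le_rfl) s t hs ht).2
        simpa only [pow_succ] using this
  have hδ : 0 < δ := (abs_nonneg s).trans_lt hs
  have hmom : ∀ i ≤ D.card, ∑ d ∈ D, d ^ i * iteratedDeriv D.card (Ψ d) s = 0 := by
    intro i hi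
    simpa using hall D.card i hi s 0 hs (by simpa using hδ)
  -- pair the moments with the Lagrange basis polynomial of the node `d₀`
  set P : Polynomial ℝ := Lagrange.basis D id d₀ with hP
  have hPdeg : P.natDegree ≤ D.card := by
    rw [hP, Lagrange.natDegree_basis (Set.injOn_id _) hd₀]
    omega
  have hsum : ∑ d ∈ D, P.eval d * iteratedDeriv D.card (Ψ d) s = 0 := by
    simp_rw [Polynomial.eval_eq_sum_range, Finset.sum_mul]
    rw [Finset.sum_comm]
    refine Finset.sum_eq_zero fun i hi => ?_
    have := hmom i ((Nat.lt_succ_iff.1 (Finset.mem_range.1 hi)).trans hPdeg)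
    simp_rw [mul_assoc]
    rw [← Finset.mul_sum, this, mul_zero]
  rw [Finset.sum_eq_single_of_mem d₀ hd₀] at hsum
  · have : P.eval d₀ = 1 := Lagrange.eval_basis_self (v := id) (Set.injOn_id _) hd₀
    rwa [this, one_mul] at hsum
  · intro d hd hne
    have : P.eval d = 0 := Lagrange.eval_basis_of_ne (v := id) (Ne.symm hne) hd
    rw [this, zero_mul]

/-- A pointwise limit of polynomials of bounded degree on an interval is a polynomial. -/
theorem exists_polynomial_of_tendsto {δ : ℝ} (hδ : 0 < δ) {N : ℕ} {p : ℕ → Polynomial ℝ}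
    (hp : ∀ n, (p n).degree < N) {f : ℝ → ℝ}
    (hf : ∀ s, |s| < δ → Tendsto (fun n => (p n).eval s) atTop (𝓝 (f s))) :
    ∃ q : Polynomial ℝ, ∀ s, |s| < δ → f s = q.eval s := by
  set v : ℕ → ℝ := fun i => δ * (1 / (i + 2)) with hv
  have hvδ : ∀ i, |v i| < δ := by
    intro i
    have h1 : (0 : ℝ) < 1 / (i + 2) := by positivity
    have h2 : (1 : ℝ) / (i + 2) < 1 := by
      rw [div_lt_one (by positivity)]
      have : (0 : ℝ) ≤ i := by positivity
      linarith
    rw [hv, abs_of_pos (by positivity)]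
    nlinarith
  have hvinj : Set.InjOn v (Finset.range N) := by
    intro i _ j _ hij
    have h := mul_left_cancel₀ hδ.ne' hij
    have h' : (i : ℝ) + 2 = j + 2 := by
      have := congrArg (fun x : ℝ => x⁻¹) h
      simpa using this
    exact_mod_cast add_right_cancel h'
  refine ⟨Lagrange.interpolate (Finset.range N) v fun i => f (v i), fun s hs => ?_⟩
  refine tendsto_nhds_unique (hf s hs) ?_
  have he : ∀ n, (p n).eval s = ∑ i ∈ Finset.range N,
      (p n).eval (v i) * (Lagrange.basis (Finset.range N) v i).eval s := by
    intro n
    conv_lhs => rw [Lagrange.eq_interpolate (f := p n) hvinj (by simpa using hp n)]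
    simp [Lagrange.interpolate_apply, Polynomial.eval_finsetSum]
  simp_rw [he]
  rw [Lagrange.interpolate_apply, Polynomial.eval_finsetSum]
  simp only [Polynomial.eval_mul, Polynomial.eval_C]
  exact tendsto_finsetSum _ fun i _ => (hf (v i) (hvδ i)).mul_const _

/-- Continuous solutions of `∑ d, Ψ d (s + d * t) = 0`, with distinct slopes `d`, are polynomials
near the origin. Mollifying in `s` preserves the equation, so the smooth case and the closedness of
polynomials of bounded degree apply. -/
theorem eventually_eq_polynomial_of_sum_eq_zero {D : Finset ℝ} {Ψ : ℝ → ℝ → ℝ}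
    (hΨ : ∀ d ∈ D, Continuous (Ψ d)) {δ : ℝ} (hδ : 0 < δ)
    (h : ∀ s t : ℝ, |s| < δ → |t| < δ → ∑ d ∈ D, Ψ d (s + d * t) = 0) {d₀ : ℝ} (hd₀ : d₀ ∈ D) :
    ∃ p : Polynomial ℝ, ∀ s, |s| < δ / 2 → Ψ d₀ s = p.eval s := by
  set φ : ℕ → ContDiffBump (0 : ℝ) := fun n =>
    ⟨δ / 2 / (n + 1) / 2, δ / 2 / (n + 1), by positivity, half_lt_self (by positivity)⟩ with hφ
  have hφδ : ∀ n, (φ n).rOut ≤ δ / 2 := by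
    intro n
    simp only [hφ]
    exact div_le_self (by positivity) (by
      have : (0 : ℝ) ≤ n := by positivity
      linarith)
  have hφ0 : Tendsto (fun n => (φ n).rOut) atTop (𝓝 0) := by
    have := (tendsto_one_div_add_atTop_nhds_zero_nat (𝕜 := ℝ)).const_mul (δ / 2)
    simpa [hφ, div_eq_mul_inv] using this
  set Ψs : ℕ → ℝ → ℝ → ℝ := fun n d =>
    (φ n).normed volume ⋆[ContinuousLinearMap.lsmul ℝ ℝ, volume] Ψ d with hΨs
  have hsmooth : ∀ n, ∀ d ∈ D, ContDiff ℝ ∞ (Ψs n d) := fun n d hd =>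
    (φ n).hasCompactSupport_normed.contDiff_convolution_left _ (φ n).contDiff_normed
      ((hΨ d hd).locallyIntegrable)
  have heq : ∀ n, ∀ s t : ℝ, |s| < δ / 2 → |t| < δ / 2 → ∑ d ∈ D, Ψs n d (s + d * t) = 0 := by
    intro n s t hs ht
    have hint : ∀ d ∈ D, Integrable (fun u => (φ n).normed volume u * Ψ d (s + d * t - u)) := by
      intro d hd
      refine Continuous.integrable_of_hasCompactSupport ?_ ?_
      · exact (φ n).continuous_normed.mul ((hΨ d hd).comp (by fun_prop))
      · exact (φ n).hasCompactSupport_normed.mul_right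
    have : ∀ d, Ψs n d (s + d * t) = ∫ u, (φ n).normed volume u * Ψ d (s + d * t - u) := by
      intro d
      simp [hΨs, convolution_def]
    simp_rw [this]
    rw [← integral_finsetSum _ hint]
    refine integral_eq_zero_of_ae (Eventually.of_forall fun u => ?_)
    simp only [Pi.zero_apply]
    rw [← Finset.mul_sum]
    by_cases hu : u ∈ Metric.ball (0 : ℝ) (φ n).rOut
    · have hu' : |u| < (φ n).rOut := by simpa using hu
      have := h (s - u) t
        ((abs_sub s u).trans_lt (by linarith [hφδ n])) (by linarith)
      have e : ∀ d, s + d * t - u = s - u + d * t := fun d => by ring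
      simp_rw [e, this, mul_zero]
    · rw [← (φ n).support_normed_eq (μ := volume), Function.notMem_support] at hu
      rw [hu, zero_mul]
  have hpoly : ∀ n, ∃ p : Polynomial ℝ, p.degree < D.card ∧
      ∀ s, |s| < δ / 2 → Ψs n d₀ s = p.eval s := fun n =>
    exists_polynomial_of_iteratedDeriv_eq_zero D.card (hsmooth n d₀ hd₀) fun s hs =>
      iteratedDeriv_eq_zero_of_sum_eq_zero (hsmooth n) (heq n) hd₀ hs
  choose p hp hpe using hpoly
  refine exists_polynomial_of_tendsto (half_pos hδ) hp fun s hs => ?_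
  have := ContDiffBump.convolution_tendsto_right_of_continuous (μ := volume) hφ0 (hΨ d₀ hd₀) s
  refine this.congr fun n => ?_
  exact hpe n s hs

end HeydeRZ2

namespace HeydeRZ2

open Filter Topology Complex

/-! ### Measures whose characteristic function extends to an entire function -/

/-- The symmetric second difference quotient of an entire function is bounded near the origin. -/
theorem exists_norm_second_difference_le {G : ℂ → ℂ} (hG : Differentiable ℂ G) :
    ∃ B : ℝ, ∀ᶠ z in 𝓝 (0 : ℂ), ‖2 * G 0 - G z - G (-z)‖ ≤ B * ‖z‖ ^ 2 := by
  set ψ : ℂ → ℂ := fun z => 2 * G 0 - G z - G (-z) with hψ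
  have hGn : Differentiable ℂ fun z => G (-z) := hG.comp differentiable_neg
  have hψd : Differentiable ℂ ψ := ((differentiable_const _).sub hG).sub hGn
  have hds : ∀ f : ℂ → ℂ, Differentiable ℂ f → Differentiable ℂ (dslope f 0) := fun f hf =>
    differentiableOn_univ.1 ((differentiableOn_dslope univ_mem).2 hf.differentiableOn)
  have hψ0 : ψ 0 = 0 := by simp only [hψ, neg_zero]; ring
  have hχ0 : dslope ψ 0 0 = 0 := by
    rw [dslope_same]
    have h1 : HasDerivAt (fun z => G (-z)) (-deriv G 0) 0 := by
      have h0 : HasDerivAt G (deriv G 0) (-(0 : ℂ)) := by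
        rw [neg_zero]; exact (hG 0).hasDerivAt
      simpa [Function.comp_def] using h0.comp (0 : ℂ) (hasDerivAt_neg (0 : ℂ))
    have h2 := ((hasDerivAt_const (0 : ℂ) (2 * G 0)).sub (hG 0).hasDerivAt).sub h1
    refine (HasDerivAt.deriv (f := ψ) h2).trans ?_
    ring
  set χ := dslope (dslope ψ 0) 0 with hχ
  have hfac : ∀ z, ψ z = z ^ 2 * χ z := by
    intro z
    have h1 := sub_smul_dslope ψ 0 z
    have h2 := sub_smul_dslope (dslope ψ 0) 0 z
    rw [hψ0, sub_zero, sub_zero, smul_eq_mul] at h1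
    rw [hχ0, sub_zero, sub_zero, smul_eq_mul] at h2
    rw [← h1, ← h2]
    ring
  have hcont : ContinuousAt χ 0 := (hds _ (hds _ hψd)).continuous.continuousAt
  refine ⟨‖χ 0‖ + 1, ?_⟩
  filter_upwards [hcont.norm.eventually_lt continuousAt_const (lt_add_one ‖χ 0‖)] with z hz
  change ‖ψ z‖ ≤ _
  rw [hfac, norm_mul, norm_pow, mul_comm]
  gcongr

theorem iteratedDeriv_comp_ofReal {E : ℂ → ℂ} (hE : Differentiable ℂ E) (n : ℕ) (s : ℝ) :
    iteratedDeriv n (fun s : ℝ => E s) s = iteratedDeriv n E s := by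
  induction n generalizing s with
  | zero => simp
  | succ n ih =>
    rw [iteratedDeriv_succ, iteratedDeriv_succ, funext ih]
    have hd : DifferentiableAt ℂ (iteratedDeriv n E) s :=
      (hE.contDiff (n := ⊤)).differentiable_iteratedDeriv n
        (by exact_mod_cast WithTop.coe_lt_top _) _
    exact (hd.hasDerivAt.comp_ofReal).deriv

theorem tendsto_two_sub_two_cos_div_sq (x : ℝ) :
    Tendsto (fun h : ℝ => (2 - 2 * Real.cos (h * x)) / h ^ 2) (𝓝[≠] 0) (𝓝 (x ^ 2)) := by
  have hd : HasDerivAt (fun h : ℝ => Real.sin (h * (x / 2))) (x / 2) 0 := by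
    have h0 : HasDerivAt (fun h : ℝ => h * (x / 2)) (x / 2) 0 := by
      simpa using (hasDerivAt_id (0 : ℝ)).mul_const (x / 2)
    simpa using h0.sin
  have ht := hd.tendsto_slope_zero
  have h2 := (ht.pow 2).const_mul 4
  rw [show 4 * (x / 2) ^ 2 = x ^ 2 by ring] at h2
  refine h2.congr' ?_
  filter_upwards [self_mem_nhdsWithin] with h hh
  have hh' : h ≠ 0 := hh
  have e : h * x = 2 * (h * (x / 2)) := by ring
  rw [e, Real.cos_two_mul, Real.cos_sq']
  simp only [zero_add, zero_mul, Real.sin_zero, sub_zero, smul_eq_mul]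
  field_simp
  ring

theorem memLp_id_natCast_of_lintegral {lam : Measure ℝ} {m : ℕ} (hm : m ≠ 0) (hme : Even m)
    (h : ∫⁻ x, ENNReal.ofReal (x ^ m) ∂lam < ⊤) : MemLp id m lam := by
  refine (integrable_norm_rpow_iff (by fun_prop) (by exact_mod_cast hm) (by simp)).1 ?_
  have : (fun x : ℝ => ‖id x‖ ^ ((m : ENNReal)).toReal) = fun x => x ^ m := by
    ext x
    simp [hme.pow_abs]
  rw [this]
  refine ⟨by fun_prop, ?_⟩
  rw [hasFiniteIntegral_iff_ofReal (Eventually.of_forall fun x => hme.pow_nonneg x)]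
  exact h

section

variable {lam : Measure ℝ} {E : ℂ → ℂ} {δ : ℝ}

theorem iteratedDeriv_charFun_eq_of_entire (hE : Differentiable ℂ E)
    (h : ∀ s : ℝ, |s| < δ → charFun lam s = E s) (n : ℕ) {s : ℝ} (hs : |s| < δ) :
    iteratedDeriv n (charFun lam) s = iteratedDeriv n E s := by
  rw [← iteratedDeriv_comp_ofReal hE]
  refine Filter.EventuallyEq.iteratedDeriv_eq n ?_
  filter_upwards [continuous_abs.continuousAt.eventually_lt continuousAt_const hs] with y hy
  exact h y hy

/-- If the characteristic function agrees near the origin with an entire function, all moments are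
finite: the second difference quotients of its derivative of order `2 * k` are bounded, so Fatou's
lemma gives the moment of order `2 * k + 2`. -/
theorem memLp_id_of_charFun_eq_entire [IsFiniteMeasure lam] (hδ : 0 < δ) (hE : Differentiable ℂ E)
    (h : ∀ s : ℝ, |s| < δ → charFun lam s = E s) (k : ℕ) :
    MemLp id (2 * k : ℕ) lam := by
  induction k with
  | zero => simpa using (aestronglyMeasurable_id : AEStronglyMeasurable (id : ℝ → ℝ) lam)
  | succ k ih =>
    set m := 2 * k with hm
    have hme : Even m := even_two_mul k
    set G := iteratedDeriv m E with hG
    have hGd : Differentiable ℂ G := (hE.contDiff (n := ⊤)).differentiable_iteratedDeriv m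
        (by exact_mod_cast WithTop.coe_lt_top _)
    have hint : Integrable (fun x : ℝ => x ^ m) lam := by
      have := ih.integrable_norm_pow'
      simpa [hme.pow_abs] using this
    have hintc : ∀ s : ℝ, Integrable (fun x : ℝ => (x : ℂ) ^ m * exp (s * x * I)) lam := by
      intro s
      refine (hint.norm).mono' (by fun_prop) (Eventually.of_forall fun x => ?_)
      have : ‖exp ((s : ℂ) * x * I)‖ = 1 := by
        rw [← ofReal_mul]; exact norm_exp_ofReal_mul_I _
      simp [this]
    have hGs : ∀ s : ℝ, |s| < δ → G s = I ^ m * ∫ x, (x : ℂ) ^ m * exp (s * x * I) ∂lam := by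
      intro s hs
      rw [← iteratedDeriv_charFun ih, iteratedDeriv_charFun_eq_of_entire hE h m hs]
    have hdiff : ∀ s : ℝ, |s| < δ →
        ‖2 * G 0 - G s - G (-s)‖ = ∫ x, x ^ m * (2 - 2 * Real.cos (s * x)) ∂lam := by
      intro s hs
      have h0 := hGs 0 (by simpa using hδ)
      have h1 := hGs (-s) (by simpa using hs)
      rw [ofReal_neg] at h1
      rw [ofReal_zero] at h0
      rw [h0, hGs s hs, h1]
      have e : 2 * (I ^ m * ∫ x : ℝ, (x : ℂ) ^ m * exp (0 * x * I) ∂lam)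
          - I ^ m * (∫ x : ℝ, (x : ℂ) ^ m * exp (s * x * I) ∂lam)
          - I ^ m * (∫ x : ℝ, (x : ℂ) ^ m * exp (-s * x * I) ∂lam)
          = I ^ m * ((∫ x, x ^ m * (2 - 2 * Real.cos (s * x)) ∂lam : ℝ) : ℂ) := by
        have i0 := hintc 0
        have i1 := hintc (-s)
        rw [ofReal_neg] at i1
        rw [ofReal_zero] at i0
        rw [mul_left_comm, ← mul_sub, ← mul_sub, ← integral_const_mul,
          ← integral_sub (i0.const_mul 2) (hintc s), ← integral_sub _ i1, ← integral_complex_ofReal]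
        · congr 1
          refine integral_congr_ae (Eventually.of_forall fun x => ?_)
          simp only
          push_cast
          rw [Complex.cos, zero_mul, zero_mul, exp_zero]
          ring_nf
        · exact (i0.const_mul 2).sub (hintc s)
      rw [e, norm_mul, norm_pow, norm_I, one_pow, one_mul, norm_real, Real.norm_eq_abs,
        abs_of_nonneg]
      refine integral_nonneg fun x => mul_nonneg (hme.pow_nonneg x) ?_
      linarith [Real.cos_le_one (s * x)]
    obtain ⟨B, hB⟩ := exists_norm_second_difference_le hGd
    have hseq : Tendsto (fun n : ℕ => (1 : ℝ) / (n + 1)) atTop (𝓝[≠] 0) := by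
      refine tendsto_nhdsWithin_iff.2 ⟨tendsto_one_div_add_atTop_nhds_zero_nat, ?_⟩
      exact Eventually.of_forall fun n => (by positivity : (0 : ℝ) < 1 / (n + 1)).ne'
    set u : ℕ → ℝ := fun n => (1 : ℝ) / (n + 1) with hu
    have hu0 : Tendsto u atTop (𝓝 0) := hseq.mono_right nhdsWithin_le_nhds
    have hfat : ∫⁻ x, ENNReal.ofReal (x ^ (m + 2)) ∂lam ≤ ENNReal.ofReal B := by
      have hlim : ∀ x : ℝ, ENNReal.ofReal (x ^ (m + 2)) = liminf (fun n =>
          ENNReal.ofReal (x ^ m * ((2 - 2 * Real.cos (u n * x)) / u n ^ 2))) atTop := by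
        intro x
        refine (Tendsto.liminf_eq ?_).symm
        rw [pow_add]
        exact ENNReal.tendsto_ofReal
          (((tendsto_two_sub_two_cos_div_sq x).comp hseq).const_mul (x ^ m))
      simp_rw [hlim]
      refine (lintegral_liminf_le fun n => by fun_prop).trans ?_
      refine liminf_le_of_frequently_le' (Eventually.frequently ?_)
      have hc : Tendsto (fun n => (u n : ℂ)) atTop (𝓝 0) :=
        (continuous_ofReal.tendsto' 0 0 (by simp)).comp hu0
      have hδ' : ∀ᶠ n in atTop, |u n| < δ :=
        (hu0.abs).eventually_lt tendsto_const_nhds (by simpa using hδ)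
      filter_upwards [hc.eventually hB, hδ'] with n hn hnδ
      rw [hdiff _ hnδ, norm_real, Real.norm_eq_abs, sq_abs] at hn
      have hup : 0 < u n ^ 2 := by simp only [hu]; positivity
      rw [← ofReal_integral_eq_lintegral_ofReal]
      · refine ENNReal.ofReal_le_ofReal ?_
        simp_rw [← mul_div_assoc]
        rw [integral_div, div_le_iff₀ hup]
        exact hn
      · refine (hint.norm.const_mul (4 / u n ^ 2)).mono' (by fun_prop)
          (Eventually.of_forall fun x => ?_)
        rw [norm_mul, mul_comm (4 / u n ^ 2)]
        refine mul_le_mul_of_nonneg_left ?_ (norm_nonneg _)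
        rw [norm_div, Real.norm_of_nonneg hup.le, Real.norm_eq_abs]
        refine div_le_div_of_nonneg_right ?_ hup.le
        rw [abs_le]
        constructor <;> linarith [Real.cos_le_one (u n * x), Real.neg_one_le_cos (u n * x)]
      · refine Eventually.of_forall fun x => mul_nonneg (hme.pow_nonneg x) (div_nonneg ?_ hup.le)
        linarith [Real.cos_le_one (u n * x)]
    have e2 : 2 * (k + 1) = m + 2 := by omega
    rw [e2]
    exact memLp_id_natCast_of_lintegral (by omega) (hme.add even_two)
      (hfat.trans_lt ENNReal.ofReal_lt_top)

/-- If the characteristic function agrees near the origin with an entire function `E`, all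
exponential moments are finite: the even moments are, up to sign, the Taylor coefficients of `E`,
so the power series of `∫ cosh (r * x)` converges. -/
theorem integrable_exp_of_charFun_eq_entire [IsFiniteMeasure lam] (hδ : 0 < δ) (hE : Differentiable ℂ E)
    (h : ∀ s : ℝ, |s| < δ → charFun lam s = E s) (r : ℝ) :
    Integrable (fun x => Real.exp (r * x)) lam := by
  have hmem := memLp_id_of_charFun_eq_entire hδ hE h
  have hint : ∀ k : ℕ, Integrable (fun x : ℝ => x ^ (2 * k)) lam := by
    intro k
    have := (hmem k).integrable_norm_pow'
    simpa [(even_two_mul k).pow_abs] using this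
  have hmom : ∀ k : ℕ, ∫ x, x ^ (2 * k) ∂lam = ‖iteratedDeriv (2 * k) E 0‖ := by
    intro k
    have h1 := iteratedDeriv_charFun_zero (hmem k)
    rw [iteratedDeriv_charFun_eq_of_entire hE h _ (by simpa using hδ), ofReal_zero] at h1
    rw [h1, norm_mul, norm_pow, norm_I, one_pow, one_mul, norm_real, Real.norm_eq_abs,
      abs_of_nonneg (integral_nonneg fun x => (even_two_mul k).pow_nonneg x)]
  have hsum : Summable fun k : ℕ =>
      r ^ (2 * k) / (2 * k).factorial * ‖iteratedDeriv (2 * k) E 0‖ := by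
    have hs := (hasSum_taylorSeries_of_entire hE 0 (r : ℂ)).summable.norm
    have hs2 := hs.comp_injective (i := fun k : ℕ => 2 * k)
      (fun a b hab => by simpa using hab)
    refine hs2.congr fun k => ?_
    simp only [Function.comp_apply, smul_eq_mul, sub_zero, norm_mul, norm_inv, norm_pow,
      norm_natCast, norm_real, Real.norm_eq_abs, (even_two_mul k).pow_abs]
    ring
  have hcosh : ∫⁻ x, ENNReal.ofReal (Real.cosh (r * x)) ∂lam < ⊤ := by
    have e : ∀ x : ℝ, ENNReal.ofReal (Real.cosh (r * x)) =
        ∑' k : ℕ, ENNReal.ofReal ((r * x) ^ (2 * k) / (2 * k).factorial) := by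
      intro x
      rw [← ENNReal.ofReal_tsum_of_nonneg _ (Real.hasSum_cosh (r * x)).summable,
        (Real.hasSum_cosh (r * x)).tsum_eq]
      intro k
      exact div_nonneg ((even_two_mul k).pow_nonneg _) (by positivity)
    simp_rw [e]
    rw [lintegral_tsum fun k => by fun_prop]
    have e2 : ∀ k : ℕ, ∫⁻ x, ENNReal.ofReal ((r * x) ^ (2 * k) / (2 * k).factorial) ∂lam =
        ENNReal.ofReal (r ^ (2 * k) / (2 * k).factorial * ‖iteratedDeriv (2 * k) E 0‖) := by
      intro k
      rw [← ofReal_integral_eq_lintegral_ofReal]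
      · congr 1
        rw [← hmom, ← integral_const_mul]
        refine integral_congr_ae (Eventually.of_forall fun x => ?_)
        simp only [mul_pow]
        ring
      · refine ((hint k).const_mul (r ^ (2 * k) / (2 * k).factorial)).congr
          (Eventually.of_forall fun x => ?_)
        simp only [mul_pow]
        ring
      · exact Eventually.of_forall fun x =>
          div_nonneg ((even_two_mul k).pow_nonneg _) (by positivity)
    simp_rw [e2]
    rw [← ENNReal.ofReal_tsum_of_nonneg _ hsum]
    · exact ENNReal.ofReal_lt_top
    · intro k
      exact mul_nonneg (div_nonneg ((even_two_mul k).pow_nonneg _) (by positivity)) (norm_nonneg _)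
  have hcoshi : Integrable (fun x => Real.cosh (r * x)) lam := by
    refine ⟨(Real.continuous_cosh.comp (by fun_prop)).aestronglyMeasurable, ?_⟩
    rw [hasFiniteIntegral_iff_ofReal (Eventually.of_forall fun x => (Real.cosh_pos _).le)]
    exact hcosh
  refine (hcoshi.const_mul 2).mono' (by fun_prop) (Eventually.of_forall fun x => ?_)
  rw [Real.norm_of_nonneg (Real.exp_pos _).le, Real.cosh_eq]
  linarith [Real.exp_pos (-(r * x))]

theorem differentiable_complexMGF (h : ∀ r : ℝ, Integrable (fun x => Real.exp (r * x)) lam) :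
    Differentiable ℂ (complexMGF id lam) := by
  have hu : integrableExpSet id lam = Set.univ := Set.eq_univ_of_forall fun r => h r
  intro z
  exact (hasDerivAt_complexMGF (X := id) (μ := lam) (by simp [hu])).differentiableAt

end

end HeydeRZ2

namespace HeydeRZ2

open Filter Topology Complex

/-! ### The theorems of Marcinkiewicz and Cramér -/

theorem norm_polynomial_eval_le (p : Polynomial ℂ) (z : ℂ) :
    ‖p.eval z‖ ≤ (∑ i ∈ Finset.range (p.natDegree + 1), ‖p.coeff i‖) *
      (1 + ‖z‖) ^ p.natDegree := by
  rw [Polynomial.eval_eq_sum_range, Finset.sum_mul]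
  refine (norm_sum_le _ _).trans (Finset.sum_le_sum fun i hi => ?_)
  rw [norm_mul, norm_pow]
  have hz := norm_nonneg z
  gcongr
  calc ‖z‖ ^ i ≤ (1 + ‖z‖) ^ i := by gcongr; linarith
    _ ≤ (1 + ‖z‖) ^ p.natDegree :=
      pow_le_pow_right₀ (by linarith) (Nat.lt_succ_iff.1 (Finset.mem_range.1 hi))

theorem integrable_exp_right_of_conv {ρ κ : Measure ℝ} [IsProbabilityMeasure ρ]
    [IsProbabilityMeasure κ] {r : ℝ} (h : Integrable (fun x => Real.exp (r * x)) (ρ ∗ κ)) :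
    Integrable (fun x => Real.exp (r * x)) κ := by
  obtain ⟨x, hx⟩ := ((integrable_conv_iff (by fun_prop)).1 h).1.exists
  refine (hx.const_mul (Real.exp (-(r * x)))).congr (Eventually.of_forall fun y => ?_)
  simp only
  rw [← Real.exp_add]
  ring_nf

/-- Jensen's inequality for the moment generating function. -/
theorem exp_mul_integral_le_mgf {κ : Measure ℝ} [IsProbabilityMeasure κ]
    (h : ∀ r : ℝ, Integrable (fun x => Real.exp (r * x)) κ) (r : ℝ) :
    Real.exp (r * ∫ x, x ∂κ) ≤ mgf id κ r := by
  have hu : integrableExpSet id κ = Set.univ := Set.eq_univ_of_forall fun r => h r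
  have hx : Integrable (fun x : ℝ => x) κ :=
    integrable_of_mem_interior_integrableExpSet (X := id) (μ := κ) (by simp [hu])
  set m := ∫ x, x ∂κ with hm
  have hl : Integrable (fun x => r * (x - m)) κ := (hx.sub (integrable_const m)).const_mul r
  have hi : Integrable (fun x => Real.exp (r * m) * (1 + r * (x - m))) κ :=
    ((integrable_const (1 : ℝ)).add hl).const_mul _
  have he : ∫ x, Real.exp (r * m) * (1 + r * (x - m)) ∂κ = Real.exp (r * m) := by
    rw [integral_const_mul, integral_add (integrable_const _) hl, integral_const_mul,
      integral_sub hx (integrable_const m), ← hm]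
    simp
  rw [mgf, ← he]
  refine integral_mono hi (h r) fun x => ?_
  simp only [id_eq]
  have h1 := Real.add_one_le_exp (r * (x - m))
  calc Real.exp (r * m) * (1 + r * (x - m)) ≤ Real.exp (r * m) * Real.exp (r * (x - m)) := by
        gcongr; linarith
    _ = Real.exp (r * x) := by rw [← Real.exp_add]; ring_nf

theorem conj_complexMGF_ofReal (lam : Measure ℝ) (x : ℝ) :
    (starRingEnd ℂ) (complexMGF id lam x) = complexMGF id lam x := by
  rw [complexMGF_ofReal, conj_ofReal]

/-- The theorems of Marcinkiewicz and Cramér combined: a factor of a characteristic function that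
is the exponential of a polynomial near the origin is Gaussian. The factor extends to a zero-free
entire function of finite order, hence is the exponential of a polynomial, and the ridge property
of characteristic functions bounds the degree by two. -/
theorem isGaussianLaw_of_charFun_mul_eq_exp {ρ κ : Measure ℝ} [IsProbabilityMeasure ρ]
    [IsProbabilityMeasure κ] {p : Polynomial ℂ} {δ : ℝ} (hδ : 0 < δ)
    (h : ∀ s : ℝ, |s| < δ → charFun ρ s * charFun κ s = exp (p.eval (s : ℂ))) :
    IsGaussianLaw ρ := by
  have hE : Differentiable ℂ fun z => exp (p.eval z) := p.differentiable.cexp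
  have hρ : ∀ r : ℝ, Integrable (fun x => Real.exp (r * x)) ρ := fun r =>
    integrable_exp_right_of_conv (ρ := κ)
      (integrable_exp_of_charFun_eq_entire hδ hE
        (fun s hs => by rw [charFun_conv, mul_comm, h s hs]) r)
  have hκ : ∀ r : ℝ, Integrable (fun x => Real.exp (r * x)) κ := fun r =>
    integrable_exp_right_of_conv (ρ := ρ)
      (integrable_exp_of_charFun_eq_entire hδ hE (fun s hs => by rw [charFun_conv, h s hs]) r)
  set M := complexMGF id ρ with hM
  have hMd : Differentiable ℂ M := differentiable_complexMGF hρ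
  have hprod : ∀ z, M z * complexMGF id κ z = exp (p.eval (-I * z)) := by
    intro z
    have hI : Differentiable ℂ fun z : ℂ => z * I := by fun_prop
    have := entire_eq_of_eq_ofReal (f := fun z => M (z * I) * complexMGF id κ (z * I))
      (g := fun z => exp (p.eval z)) ((hMd.comp hI).mul ((differentiable_complexMGF hκ).comp hI))
      hE hδ fun s hs => by
        simp only [hM, complexMGF_id_mul_I]
        exact h s hs
    have hz := congrFun this (-I * z)
    have e : -I * z * I = z := by linear_combination (-z) * I_sq
    simpa only [e] using hz
  have hM0 : ∀ z, M z ≠ 0 := by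
    intro z hz
    have := hprod z
    rw [hz, zero_mul] at this
    exact exp_ne_zero _ this.symm
  set N := p.natDegree
  set K : ℝ := ∑ i ∈ Finset.range (N + 1), ‖p.coeff i‖ with hK
  have hK0 : 0 ≤ K := Finset.sum_nonneg fun i _ => norm_nonneg _
  set m := ∫ x, x ∂κ
  have hbound : ∀ z, ‖M z‖ ≤ Real.exp ((K + |m|) * (1 + ‖z‖) ^ (N + 1)) := by
    intro z
    set x := z.re with hx
    have hxz : |x| ≤ ‖z‖ := abs_re_le_norm z
    have h1 : mgf id ρ x * mgf id κ x ≤ Real.exp (K * (1 + ‖z‖) ^ N) := by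
      have := congrArg norm (hprod x)
      rw [hM, complexMGF_ofReal, complexMGF_ofReal, ← ofReal_mul, norm_real,
        Real.norm_of_nonneg (mul_nonneg mgf_nonneg mgf_nonneg), norm_exp] at this
      rw [this, Real.exp_le_exp]
      refine (re_le_norm _).trans ((norm_polynomial_eval_le p _).trans ?_)
      rw [norm_mul, norm_neg, norm_I, one_mul, norm_real, Real.norm_eq_abs]
      gcongr
    have h2 : Real.exp (-(|m| * ‖z‖)) ≤ mgf id κ x := by
      refine le_trans ?_ (exp_mul_integral_le_mgf hκ x)
      rw [Real.exp_le_exp]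
      have := neg_abs_le (x * m)
      rw [abs_mul] at this
      have h3 : |x| * |m| ≤ ‖z‖ * |m| := by gcongr
      linarith
    have h3 : mgf id ρ x ≤ Real.exp (K * (1 + ‖z‖) ^ N) * Real.exp (|m| * ‖z‖) := by
      rw [← div_le_iff₀ (Real.exp_pos _), div_eq_mul_inv, ← Real.exp_neg]
      exact (mul_le_mul_of_nonneg_left h2 mgf_nonneg).trans h1
    refine norm_complexMGF_le_mgf.trans (h3.trans ?_)
    rw [← Real.exp_add, Real.exp_le_exp, add_mul]
    have hz1 : 1 ≤ 1 + ‖z‖ := by linarith [norm_nonneg z]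
    have h4 : (1 + ‖z‖) ^ N ≤ (1 + ‖z‖) ^ (N + 1) := pow_le_pow_right₀ hz1 (Nat.le_succ N)
    have h5 : ‖z‖ ≤ (1 + ‖z‖) ^ (N + 1) := by
      refine le_trans ?_ (le_self_pow₀ hz1 (Nat.succ_ne_zero N))
      linarith
    gcongr
  obtain ⟨q, -, hq⟩ := exists_eq_exp_polynomial hMd hM0 hbound
  have hdeg : q.natDegree ≤ 2 := by
    refine natDegree_le_two_of_ridge q fun z => ?_
    have h1 : ‖M z‖ ≤ ‖M (z.re : ℂ)‖ := by
      refine norm_complexMGF_le_mgf.trans ?_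
      rw [hM, complexMGF_ofReal, norm_real]
      exact le_abs_self _
    rwa [hq, hq, norm_exp, norm_exp, Real.exp_le_exp] at h1
  obtain ⟨k, σ, β, -, hσ, hk, hform⟩ := exists_gaussian_form hdeg hq
    (conj_complexMGF_ofReal ρ) (B := 1)
    (fun s => by rw [hM, complexMGF_id_mul_I]; exact norm_charFun_le_one s)
  have hk1 : (k : ℂ) = 1 := by
    have h0 := complexMGF_id_mul_I (μ := ρ) 0
    rw [ofReal_zero, zero_mul, charFun_zero] at h0
    rw [← hk, hM, h0]
    simp
  refine ⟨β, (2 * σ).toNNReal, Measure.ext_of_charFun (funext fun s => ?_)⟩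
  rw [← complexMGF_id_mul_I, ← hM, hform, hk1, one_mul, charFun_gaussianReal]
  congr 1
  rw [Real.coe_toNNReal _ (by positivity)]
  push_cast
  ring

/-! ### Heyde's theorem on the real line -/

/-- A product of squared moduli of characteristic functions is the characteristic function of the
convolution of the symmetrized distributions. -/
theorem exists_charFun_eq_prod_norm_sq {ι : Type*} (S : Finset ι) (ρ : ι → Measure ℝ)
    [∀ j, IsProbabilityMeasure (ρ j)] :
    ∃ κ : Measure ℝ, IsProbabilityMeasure κ ∧
      ∀ s, charFun κ s = ∏ j ∈ S, (‖charFun (ρ j) s‖ ^ 2 : ℂ) := by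
  classical
  induction S using Finset.induction_on with
  | empty => exact ⟨Measure.dirac 0, inferInstance, fun s => by simp [charFun_dirac]⟩
  | insert j S hj ih =>
    obtain ⟨κ, hκ, h⟩ := ih
    have : IsProbabilityMeasure ((ρ j).map fun x => -1 * x) :=
      Measure.isProbabilityMeasure_map (by fun_prop)
    refine ⟨(ρ j ∗ (ρ j).map fun x => -1 * x) ∗ κ, inferInstance, fun s => ?_⟩
    rw [charFun_conv, charFun_conv, charFun_map_mul, h, Finset.prod_insert hj, neg_one_mul,
      charFun_neg, mul_conj, normSq_eq_norm_sq]
    push_cast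
    rfl

/-- Symmetrizing and taking logarithms turns the Heyde equation into a linear functional equation
with distinct slopes, once the factors with equal coefficients are grouped together. -/
theorem exists_prod_norm_sq_charFun_eq_exp {ι : Type*} [Fintype ι] {ρ : ι → Measure ℝ}
    [∀ j, IsProbabilityMeasure (ρ j)] {c : ι → ℝ} (hc : ∀ i j, c i + c j ≠ 0)
    (heq : ∀ s t : ℝ, ∏ j, charFun (ρ j) (s + c j * t) = ∏ j, charFun (ρ j) (s - c j * t))
    (j₀ : ι) : ∃ (δ : ℝ) (p : Polynomial ℝ), 0 < δ ∧ ∀ s, |s| < δ →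
      ∏ j with c j = c j₀, ‖charFun (ρ j) s‖ ^ 2 = Real.exp (p.eval s) := by
  classical
  set g : ι → ℝ → ℝ := fun j s => ‖charFun (ρ j) s‖ ^ 2 with hg
  have hgc : ∀ j, Continuous (g j) := fun j => continuous_charFun.norm.pow 2
  have hg0 : ∀ j, g j 0 = 1 := fun j => by simp [hg, charFun_zero]
  have hgeq : ∀ s t : ℝ, ∏ j, g j (s + c j * t) = ∏ j, g j (s - c j * t) := by
    intro s t
    simp only [hg, Finset.prod_pow, ← norm_prod, heq]
  -- near the origin all factors exceed `1 / 2`, so the truncated logarithms are the logarithms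
  set Φ : ι → ℝ → ℝ := fun j s => Real.log (max (g j s) (1 / 2)) with hΦ
  have hΦc : ∀ j, Continuous (Φ j) := fun j =>
    ((hgc j).max continuous_const).log fun s =>
      (lt_max_of_lt_right (by norm_num : (0 : ℝ) < 1 / 2)).ne'
  have hev : ∀ᶠ s in 𝓝 (0 : ℝ), ∀ j, 1 / 2 < g j s := by
    refine eventually_all.2 fun j => ?_
    exact continuousAt_const.eventually_lt (hgc j).continuousAt (by rw [hg0]; norm_num)
  obtain ⟨ε, hε, hball⟩ := Metric.eventually_nhds_iff.1 hev
  have hhalf : ∀ s, |s| < ε → ∀ j, 1 / 2 < g j s := fun s hs => hball (by simpa using hs)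
  have hΦe : ∀ s, |s| < ε → ∀ j, Φ j s = Real.log (g j s) := fun s hs j => by
    simp only [hΦ, max_eq_left (hhalf s hs j).le]
  set A : ℝ := 1 + ∑ j, |c j| with hA
  have hA0 : 0 < A := by
    have : 0 ≤ ∑ j, |c j| := Finset.sum_nonneg fun j _ => abs_nonneg _
    linarith
  set δ := ε / A with hδ
  have hδ0 : 0 < δ := by positivity
  have hsmall : ∀ s t : ℝ, |s| < δ → |t| < δ → ∀ j, |s + c j * t| < ε ∧ |s - c j * t| < ε := by
    intro s t hs ht j
    have h1 : |c j| ≤ ∑ j, |c j| :=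
      Finset.single_le_sum (f := fun j => |c j|) (fun j _ => abs_nonneg _) (Finset.mem_univ j)
    have h2 : |s| + |c j * t| < ε := by
      rw [abs_mul]
      have h3 : |c j| * |t| ≤ (∑ j, |c j|) * δ := by gcongr
      have h4 : A * δ = ε := by rw [hδ]; field_simp
      rw [hA, add_mul, one_mul] at h4
      linarith
    exact ⟨(abs_add_le _ _).trans_lt h2, (abs_sub _ _).trans_lt h2⟩
  have hlog : ∀ s t : ℝ, |s| < δ → |t| < δ →
      ∑ j, Φ j (s + c j * t) = ∑ j, Φ j (s - c j * t) := by
    intro s t hs ht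
    have hs' := hsmall s t hs ht
    rw [Finset.sum_congr rfl fun j _ => hΦe _ (hs' j).1 j,
      Finset.sum_congr rfl fun j _ => hΦe _ (hs' j).2 j,
      ← Real.log_prod, ← Real.log_prod, hgeq]
    · exact fun j _ => (lt_trans (by norm_num) (hhalf _ (hs' j).2 j)).ne'
    · exact fun j _ => (lt_trans (by norm_num) (hhalf _ (hs' j).1 j)).ne'
  set D : Finset ℝ := Finset.univ.image c ∪ Finset.univ.image (fun j => -c j) with hD
  set Ψ : ℝ → ℝ → ℝ := fun d s =>
    (∑ j with c j = d, Φ j s) - ∑ j with -c j = d, Φ j s with hΨ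
  have hΨc : ∀ d ∈ D, Continuous (Ψ d) := fun d _ =>
    (continuous_finsetSum _ fun j _ => hΦc j).sub (continuous_finsetSum _ fun j _ => hΦc j)
  have hΨeq : ∀ s t : ℝ, |s| < δ → |t| < δ → ∑ d ∈ D, Ψ d (s + d * t) = 0 := by
    intro s t hs ht
    have h1 : ∑ d ∈ D, ∑ j with c j = d, Φ j (s + d * t) = ∑ j, Φ j (s + c j * t) := by
      rw [← Finset.sum_fiberwise_of_maps_to (s := Finset.univ) (t := D) (g := c)
        (fun j _ => by simp [hD]) fun j => Φ j (s + c j * t)]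
      refine Finset.sum_congr rfl fun d _ => Finset.sum_congr rfl fun j hj => ?_
      rw [(Finset.mem_filter.1 hj).2]
    have h2 : ∑ d ∈ D, ∑ j with -c j = d, Φ j (s + d * t) = ∑ j, Φ j (s - c j * t) := by
      rw [← Finset.sum_fiberwise_of_maps_to (s := Finset.univ) (t := D) (g := fun j => -c j)
        (fun j _ => by simp [hD]) fun j => Φ j (s - c j * t)]
      refine Finset.sum_congr rfl fun d _ => Finset.sum_congr rfl fun j hj => ?_
      rw [← (Finset.mem_filter.1 hj).2]
      congr 1
      ring
    simp only [hΨ, Finset.sum_sub_distrib]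
    rw [h1, h2, hlog s t hs ht, sub_self]
  obtain ⟨p, hp⟩ := eventually_eq_polynomial_of_sum_eq_zero hΨc hδ0 hΨeq
    (d₀ := c j₀) (by simp [hD])
  refine ⟨min (δ / 2) ε, p, lt_min (half_pos hδ0) hε, fun s hs => ?_⟩
  have hpos : ∀ j, 0 < g j s := fun j =>
    lt_trans (by norm_num) (hhalf s (hs.trans_le (min_le_right _ _)) j)
  -- the slopes on the two sides are distinct, so the group of `c j₀` contains no negative terms
  have hempty : (Finset.univ.filter fun j => -c j = c j₀) = ∅ := by
    refine Finset.filter_eq_empty_iff.2 fun j _ hj => hc j j₀ ?_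
    rw [← hj]; ring
  have hps := hp s (hs.trans_le (min_le_left _ _))
  simp only [hΨ, hempty, Finset.sum_empty, sub_zero] at hps
  rw [← hps, Real.exp_sum]
  refine Finset.prod_congr rfl fun j _ => ?_
  rw [hΦe s (hs.trans_le (min_le_right _ _)), Real.exp_log (hpos j)]

/-- **Heyde's theorem on the real line** in terms of characteristic functions. -/
theorem isGaussianLaw_of_heyde {ι : Type*} [Fintype ι] {ρ : ι → Measure ℝ}
    [∀ j, IsProbabilityMeasure (ρ j)] {c : ι → ℝ} (hc : ∀ i j, c i + c j ≠ 0)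
    (heq : ∀ s t : ℝ, ∏ j, charFun (ρ j) (s + c j * t) = ∏ j, charFun (ρ j) (s - c j * t))
    (j₀ : ι) : IsGaussianLaw (ρ j₀) := by
  classical
  obtain ⟨δ, p, hδ, hp⟩ := exists_prod_norm_sq_charFun_eq_exp hc heq j₀
  set S : Finset ι := Finset.univ.filter fun j => c j = c j₀ with hS
  obtain ⟨κ, hκ, hκe⟩ := exists_charFun_eq_prod_norm_sq (S.erase j₀) ρ
  have : IsProbabilityMeasure ((ρ j₀).map fun x => -1 * x) :=
    Measure.isProbabilityMeasure_map (by fun_prop)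
  refine isGaussianLaw_of_charFun_mul_eq_exp (ρ := ρ j₀)
    (κ := (ρ j₀).map (fun x => -1 * x) ∗ κ) (p := p.map ofRealHom) hδ fun s hs => ?_
  have h := hp s hs
  rw [← Finset.mul_prod_erase S _ (by simp [hS] : j₀ ∈ S)] at h
  have h' := congrArg (fun x : ℝ => (x : ℂ)) h
  rw [charFun_conv, charFun_map_mul, neg_one_mul, charFun_neg, hκe, ← mul_assoc, mul_conj,
    normSq_eq_norm_sq]
  push_cast at h' ⊢
  rw [h']
  congr 1
  exact (Polynomial.eval_map_apply (f := ofRealHom) (p := p) s).symm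

end HeydeRZ2

namespace HeydeRZ2

open Filter Topology

/-! ### Multiples of Gaussian distributions dominated by Gaussian distributions -/

/-- Comparison of two parabolas: the value at the vertex of the difference gives the constant. -/
theorem quadratic_comparison {p p' e L : ℝ} (hp : 0 < p)
    (h : ∀ y : ℝ, L + p * (y + e) ^ 2 ≤ p' * y ^ 2) :
    (p = p' ∧ e = 0) ∨ (p < p' ∧ L ≤ -(p * p' / (p' - p) * e ^ 2)) := by
  rcases lt_trichotomy p p' with hlt | heq | hgt
  · right
    refine ⟨hlt, ?_⟩
    have hd : 0 < p' - p := by linarith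
    have := h (p * e / (p' - p))
    have e1 : p' * (p * e / (p' - p)) ^ 2 - p * (p * e / (p' - p) + e) ^ 2
        = -(p * p' / (p' - p) * e ^ 2) := by
      field_simp
      ring
    linarith
  · left
    refine ⟨heq, ?_⟩
    subst heq
    by_contra he
    have h1 := h ((-L + 1) / (2 * p * e))
    have e1 : p * ((-L + 1) / (2 * p * e) + e) ^ 2
        = p * ((-L + 1) / (2 * p * e)) ^ 2 + (-L + 1) + p * e ^ 2 := by
      field_simp
      ring
    have := mul_nonneg hp.le (sq_nonneg e)
    linarith
  · exfalso
    have hd : 0 < p - p' := by linarith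
    set Y := Real.sqrt ((|L| + 1) / (p - p')) with hY
    have hY2 : (p - p') * Y ^ 2 = |L| + 1 := by
      rw [hY, Real.sq_sqrt (by positivity)]
      field_simp
    have h1 := h Y
    have h2 := h (-Y)
    have := mul_nonneg hp.le (sq_nonneg e)
    have := neg_abs_le L
    nlinarith

/-- If `k` times one Gaussian distribution is dominated by another one, the parameters satisfy the
inequalities in the definition of `InTheta`. -/
theorem gaussianReal_domination {m m' : ℝ} {v v' : NNReal} {k : ℝ} (hk : 0 < k)
    (h : ENNReal.ofReal k • gaussianReal m' v' ≤ gaussianReal m v) :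
    (0 < v' ∧ v' < v ∧
      k ≤ Real.sqrt (v' / v) * Real.exp (-((m - m') ^ 2 / (2 * (v - v'))))) ∨
    (v = v' ∧ m = m' ∧ k ≤ 1) := by
  have hset : ∀ s, ENNReal.ofReal k * gaussianReal m' v' s ≤ gaussianReal m v s := fun s => by
    simpa using h s
  have hk0 : ENNReal.ofReal k ≠ 0 := by simpa using hk
  have hk1 : k ≤ 1 := by simpa using hset Set.univ
  rcases eq_or_ne v 0 with rfl | hv
  · right
    have h1 : gaussianReal m' v' {m}ᶜ = 0 := by
      have := hset {m}ᶜ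
      simpa [gaussianReal_zero_var, hk0, hk] using this
    rcases eq_or_ne v' 0 with rfl | hv'
    · refine ⟨rfl, ?_, hk1⟩
      by_contra hne
      simp [gaussianReal_zero_var, Ne.symm hne] at h1
    · exfalso
      have := nullMeasurableSet_singleton (μ := gaussianReal m' v') m
      have h2 := prob_compl_eq_zero_iff₀ this
      have := nullSingletonClass_gaussianReal (μ := m') hv'
      rw [h2, measure_singleton] at h1
      exact zero_ne_one h1
  rcases eq_or_ne v' 0 with rfl | hv'
  · exfalso
    have := nullSingletonClass_gaussianReal (μ := m) hv
    have := hset {m'}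
    simp [gaussianReal_zero_var, hk.not_ge] at this
  have hvp : (0 : ℝ) < v := by exact_mod_cast pos_iff_ne_zero.2 hv
  have hvp' : (0 : ℝ) < v' := by exact_mod_cast pos_iff_ne_zero.2 hv'
  have hcont : ∀ (m : ℝ) (v : NNReal), Continuous (gaussianPDFReal m v) := fun m v => by
    unfold gaussianPDFReal; fun_prop
  -- the densities are compared almost everywhere, hence everywhere by continuity
  have hae : ∀ᵐ x, k * gaussianPDFReal m' v' x ≤ gaussianPDFReal m v x := by
    have : (fun x => ENNReal.ofReal k * gaussianPDF m' v' x) ≤ᵐ[volume] gaussianPDF m v := by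
      refine ae_le_of_forall_setLIntegral_le_of_sigmaFinite (by fun_prop) fun s hs _ => ?_
      have := hset s
      rw [gaussianReal_apply _ hv', gaussianReal_apply _ hv] at this
      rwa [lintegral_const_mul _ (by fun_prop)]
    filter_upwards [this] with x hx
    rw [gaussianPDF, gaussianPDF, ← ENNReal.ofReal_mul hk.le] at hx
    exact (ENNReal.ofReal_le_ofReal_iff (gaussianPDFReal_nonneg _ _ _)).1 hx
  have hall : ∀ x, k * gaussianPDFReal m' v' x ≤ gaussianPDFReal m v x := by
    have hopen : IsOpen {x | gaussianPDFReal m v x < k * gaussianPDFReal m' v' x} :=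
      isOpen_lt (hcont m v) ((hcont m' v').const_mul k)
    have hnull : volume {x | gaussianPDFReal m v x < k * gaussianPDFReal m' v' x} = 0 := by
      simpa [ae_iff] using hae
    have hempty := hopen.eq_empty_of_measure_zero hnull
    intro x
    by_contra hx
    exact Set.notMem_empty x (hempty ▸ (not_le.1 hx : x ∈ {x | _ < _}))
  set L := Real.log (k * Real.sqrt (v / v')) with hL
  have hsq : Real.sqrt (2 * Real.pi * v) = Real.sqrt (v / v') * Real.sqrt (2 * Real.pi * v') := by
    rw [← Real.sqrt_mul (by positivity)]
    congr 1
    field_simp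
  have hr : 0 < Real.sqrt (v / v') := Real.sqrt_pos.2 (by positivity)
  have hLexp : Real.exp L = k * Real.sqrt (v / v') := Real.exp_log (by positivity)
  have hquad : ∀ y : ℝ, L + 1 / (2 * v) * (y + (m' - m)) ^ 2 ≤ 1 / (2 * v') * y ^ 2 := by
    intro y
    have h1 := hall (m' + y)
    rw [gaussianPDFReal, gaussianPDFReal, hsq] at h1
    have h2 : 0 < Real.sqrt (2 * Real.pi * v') := Real.sqrt_pos.2 (by positivity)
    have h3 : Real.exp L * Real.exp (-(m' + y - m') ^ 2 / (2 * v')) ≤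
        Real.exp (-(m' + y - m) ^ 2 / (2 * v)) := by
      rw [hLexp]
      rw [mul_inv, mul_assoc, ← mul_assoc] at h1
      have := mul_le_mul_of_nonneg_left h1
        (by positivity : 0 ≤ Real.sqrt (v / v') * Real.sqrt (2 * Real.pi * v'))
      field_simp at this ⊢
      linarith
    rw [← Real.exp_add, Real.exp_le_exp] at h3
    have e1 : -(m' + y - m') ^ 2 / (2 * (v' : ℝ)) = -(1 / (2 * v') * y ^ 2) := by ring
    have e2 : -(m' + y - m) ^ 2 / (2 * (v : ℝ)) = -(1 / (2 * v) * (y + (m' - m)) ^ 2) := by ring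
    rw [e1, e2] at h3
    linarith
  rcases quadratic_comparison (by positivity) hquad with ⟨h1, h2⟩ | ⟨h1, h2⟩
  · right
    refine ⟨?_, by linarith, hk1⟩
    rw [one_div, one_div, inv_inj] at h1
    exact NNReal.coe_injective (by linarith)
  · left
    have hlt : (v' : ℝ) < v := by
      rw [one_div_lt_one_div (by positivity) (by positivity)] at h1
      linarith
    refine ⟨pos_iff_ne_zero.2 hv', by exact_mod_cast hlt, ?_⟩
    have hd : (0 : ℝ) < v - v' := by linarith
    have e1 : 1 / (2 * (v : ℝ)) * (1 / (2 * v')) / (1 / (2 * v') - 1 / (2 * v)) * (m' - m) ^ 2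
        = (m - m') ^ 2 / (2 * (v - v')) := by
      have e2 : 1 / (2 * (v' : ℝ)) - 1 / (2 * v) = (v - v') / (2 * v * v') := by
        field_simp
      rw [e2]
      field_simp
      ring
    rw [e1, ← Real.exp_le_exp, hLexp] at h2
    have e3 : Real.sqrt (v' / v) = (Real.sqrt (v / v'))⁻¹ := by
      rw [← Real.sqrt_inv, inv_div]
    rw [e3, inv_mul_eq_div, le_div_iff₀ hr]
    exact h2

/-! ### The two slices of a distribution on `ℝ × ℤ(2)` -/

/-- The measure `E ↦ μ (E × {k})` on the real line. -/
noncomputable def slice (μ : Measure X) (k : ZMod 2) : Measure ℝ :=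
  (μ.restrict (Prod.snd ⁻¹' {k})).map Prod.fst

instance (μ : Measure X) [IsFiniteMeasure μ] (k : ZMod 2) : IsFiniteMeasure (slice μ k) := by
  unfold slice; infer_instance

theorem restrict_snd_add_restrict_snd (μ : Measure X) :
    μ.restrict (Prod.snd ⁻¹' {0}) + μ.restrict (Prod.snd ⁻¹' {1}) = μ := by
  have e : (Prod.snd ⁻¹' {1} : Set X) = (Prod.snd ⁻¹' {0})ᶜ := by
    ext x
    have : ∀ k : ZMod 2, k = 1 ↔ ¬ k = 0 := by decide
    simpa using this x.2
  rw [e]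
  exact Measure.restrict_add_restrict_compl (measurable_snd (measurableSet_singleton _))

theorem slice_add_slice (μ : Measure X) : slice μ 0 + slice μ 1 = μ.map Prod.fst := by
  rw [slice, slice, ← Measure.map_add _ _ measurable_fst, restrict_snd_add_restrict_snd]

theorem norm_pairing (x : X) (s : ℝ) (l : ZMod 2) : ‖pairing x s l‖ = 1 := by
  rw [pairing, norm_mul, norm_pow, norm_neg, norm_one, one_pow, mul_one, Complex.norm_exp]
  simp

theorem measurable_pairing (s : ℝ) (l : ZMod 2) : Measurable fun x : X => pairing x s l := by
  unfold pairing
  refine Measurable.mul (by fun_prop) ?_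
  exact (measurable_of_countable fun k : ZMod 2 => (-1 : ℂ) ^ (k.val * l.val)).comp measurable_snd

theorem integrable_pairing (μ : Measure X) [IsFiniteMeasure μ] (s : ℝ) (l : ZMod 2) :
    Integrable (fun x => pairing x s l) μ :=
  (integrable_const (1 : ℝ)).mono' (measurable_pairing s l).aestronglyMeasurable
    (Eventually.of_forall fun x => (norm_pairing x s l).le)

theorem charFun_map_fst (μ : Measure X) (s : ℝ) :
    charFun (μ.map Prod.fst) s = ∫ x, Complex.exp (Complex.I * x.1 * s) ∂μ := by
  rw [charFun_apply_real, integral_map (by fun_prop) (by fun_prop)]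
  congr 1
  ext x
  ring_nf

theorem charFn_zero_right (μ : Measure X) (s : ℝ) :
    charFn μ s 0 = charFun (μ.map Prod.fst) s := by
  rw [charFn, charFun_map_fst]
  simp [pairing]

theorem charFn_one_right (μ : Measure X) [IsFiniteMeasure μ] (s : ℝ) :
    charFn μ s 1 = charFun (slice μ 0) s - charFun (slice μ 1) s := by
  have hsq : ∀ k : ZMod 2, MeasurableSet (Prod.snd ⁻¹' {k} : Set X) := fun k =>
    measurable_snd (measurableSet_singleton _)
  rw [charFn]
  conv_lhs => rw [← restrict_snd_add_restrict_snd μ]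
  rw [integral_add_measure (integrable_pairing _ s 1) (integrable_pairing _ s 1), slice, slice,
    charFun_map_fst, charFun_map_fst, sub_eq_add_neg, ← integral_neg]
  congr 1
  · refine setIntegral_congr_fun (hsq 0) fun x hx => ?_
    have : x.2 = 0 := hx
    simp [pairing, this]
  · refine setIntegral_congr_fun (hsq 1) fun x hx => ?_
    have : x.2 = 1 := hx
    simp [pairing, this, ZMod.val_one]

theorem charFun_add_measure (μ ν : Measure ℝ) [IsFiniteMeasure μ] [IsFiniteMeasure ν] (s : ℝ) :
    charFun (μ + ν) s = charFun μ s + charFun ν s := by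
  have h : ∀ (μ : Measure ℝ) [IsFiniteMeasure μ],
      Integrable (fun x : ℝ => Complex.exp (s * x * Complex.I)) μ := fun μ _ =>
    (integrable_const (1 : ℝ)).mono' (by fun_prop) (Eventually.of_forall fun x => by
      rw [← Complex.ofReal_mul, Complex.norm_exp_ofReal_mul_I])
  simp only [charFun_apply_real]
  rw [integral_add_measure (h μ) (h ν)]

theorem charFun_smul_measure (μ : Measure ℝ) {k : ℝ} (hk : 0 ≤ k) (s : ℝ) :
    charFun (ENNReal.ofReal k • μ) s = k * charFun μ s := by
  simp only [charFun_apply_real]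
  rw [integral_smul_measure, ENNReal.toReal_ofReal hk, Complex.real_smul]

/-- If the Fourier transform of the difference of two measures is `κ` times a characteristic
function, then `|κ|` times the corresponding distribution is dominated by the sum. -/
theorem smul_le_slice_add_slice {ν₀ ν₁ γ : Measure ℝ} [IsFiniteMeasure ν₀] [IsFiniteMeasure ν₁]
    [IsFiniteMeasure γ] {κ : ℝ}
    (h : ∀ s, charFun ν₀ s - charFun ν₁ s = κ * charFun γ s) :
    ENNReal.ofReal |κ| • γ ≤ ν₀ + ν₁ := by
  have : IsFiniteMeasure (ENNReal.ofReal |κ| • γ) := γ.smul_finite ENNReal.ofReal_ne_top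
  rcases le_total 0 κ with hκ | hκ
  · have : ν₀ = ν₁ + ENNReal.ofReal |κ| • γ := by
      refine Measure.ext_of_charFun (funext fun s => ?_)
      rw [charFun_add_measure, charFun_smul_measure _ (abs_nonneg κ), abs_of_nonneg hκ, ← h]
      ring
    rw [this]
    exact (Measure.le_add_left le_rfl).trans (Measure.le_add_right le_rfl)
  · have : ν₁ = ν₀ + ENNReal.ofReal |κ| • γ := by
      refine Measure.ext_of_charFun (funext fun s => ?_)
      rw [charFun_add_measure, charFun_smul_measure _ (abs_nonneg κ), abs_of_nonpos hκ]
      push_cast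
      rw [neg_mul, ← h]
      ring
    rw [this]
    exact (Measure.le_add_left le_rfl).trans (Measure.le_add_left le_rfl)

theorem charFun_gaussianReal_two_mul (m : ℝ) {σ : ℝ} (hσ : 0 ≤ σ) (s : ℝ) :
    charFun (gaussianReal m (2 * σ).toNNReal) s =
      Complex.exp (-(σ : ℂ) * (s : ℂ) ^ 2 + Complex.I * (m : ℂ) * (s : ℂ)) := by
  rw [charFun_gaussianReal, Real.coe_toNNReal _ (by positivity)]
  congr 1
  push_cast
  ring

/-- The inequalities in the definition of `InTheta` express that `|κ|` times the Gaussian distribution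
with variance `2 * σ'` is dominated by the real marginal of `μ`. -/
theorem inTheta_of_gaussian_forms {μ : Measure X} [IsProbabilityMeasure μ] {m : ℝ} {v : NNReal}
    (h0 : μ.map Prod.fst = gaussianReal m v) {κ σ' β' : ℝ} (hκ : κ ≠ 0) (hσ' : 0 ≤ σ')
    (h1 : ∀ s : ℝ, charFn μ s 1 =
      (κ : ℂ) * Complex.exp (-(σ' : ℂ) * (s : ℂ) ^ 2 + Complex.I * (β' : ℂ) * (s : ℂ))) :
    InTheta μ := by
  set σ : ℝ := v / 2 with hσ
  have hσ0 : 0 ≤ σ := by positivity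
  have hv : v = (2 * σ).toNNReal := by
    rw [hσ, mul_div_cancel₀ _ two_ne_zero, Real.toNNReal_coe]
  have hdom : ENNReal.ofReal |κ| • gaussianReal β' (2 * σ').toNNReal ≤ gaussianReal m v := by
    rw [← h0, ← slice_add_slice]
    refine smul_le_slice_add_slice fun s => ?_
    rw [← charFn_one_right, h1, charFun_gaussianReal_two_mul _ hσ']
  have hκ' : 0 < |κ| := abs_pos.2 hκ
  refine ⟨σ, σ', m, β', κ, hσ0, hσ', fun s => ?_, h1, ?_⟩
  · rw [charFn_zero_right, h0, hv, charFun_gaussianReal_two_mul _ hσ0]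
  · rw [hv] at hdom
    have c1 : (((2 * σ).toNNReal : NNReal) : ℝ) = 2 * σ := Real.coe_toNNReal _ (by positivity)
    have c2 : (((2 * σ').toNNReal : NNReal) : ℝ) = 2 * σ' := Real.coe_toNNReal _ (by positivity)
    rcases gaussianReal_domination hκ' hdom with ⟨a1, a2, a3⟩ | ⟨a1, a2, a3⟩
    · left
      rw [← NNReal.coe_lt_coe, c2, NNReal.coe_zero] at a1
      rw [← NNReal.coe_lt_coe, c1, c2] at a2
      rw [c1, c2, mul_div_mul_left _ _ two_ne_zero] at a3
      refine ⟨by linarith, by linarith, hκ', ?_⟩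
      rwa [show 2 * (2 * σ - 2 * σ') = 4 * (σ - σ') by ring] at a3
    · right
      have := congrArg (fun x : NNReal => (x : ℝ)) a1
      simp only [c1, c2] at this
      exact ⟨by linarith, a2, a3⟩

end HeydeRZ2

namespace HeydeRZ2

open Filter Topology

/-! ### Automorphisms of `ℝ × ℤ(2)` and the functional equation -/

/-- A topological automorphism of `ℝ × ℤ(2)` is a nonzero dilation of the first coordinate. -/
theorem exists_automorphism_apply (a : X ≃ₜ+ X) :
    ∃ α : ℝ, α ≠ 0 ∧ ∀ x : X, a x = (α * x.1, x.2) := by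
  have htwo : ∀ k : ZMod 2, k + k = 0 := by decide
  have hinj : ∀ x : X, a x = 0 → x = 0 := fun x hx => (map_eq_zero_iff a a.injective).1 hx
  set f : ℝ →+ ℝ := (AddMonoidHom.fst ℝ (ZMod 2)).comp
    ((a : X →+ X).comp (AddMonoidHom.inl ℝ (ZMod 2))) with hf
  have hfa : ∀ t, f t = (a (t, 0)).1 := fun t => rfl
  have hfc : Continuous f := by
    change Continuous fun t : ℝ => (a (t, 0)).1
    exact (a.continuous.comp (by fun_prop)).fst
  have hlin : ∀ t, (a (t, 0)).1 = f 1 * t := by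
    intro t
    have := map_real_smul f hfc t 1
    rw [smul_eq_mul, mul_one, smul_eq_mul] at this
    rw [← hfa, this, mul_comm]
  have hsnd : ∀ t : ℝ, (a (t, 0)).2 = 0 := by
    intro t
    have h : ((t, 0) : X) = (t / 2, 0) + (t / 2, 0) := by simp
    rw [h, map_add, Prod.snd_add, htwo]
  have hone : a (0, 1) = (0, 1) := by
    have h1 : a (0, 1) + a (0, 1) = 0 := by
      rw [← map_add]
      have : ((0, 1) : X) + (0, 1) = 0 := by
        rw [Prod.mk_add_mk, htwo, add_zero]; rfl
      rw [this, map_zero]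
    have h2 : (a (0, 1)).1 = 0 := by
      have := congrArg Prod.fst h1
      simp only [Prod.fst_add, Prod.fst_zero] at this
      linarith
    have h3 : (a (0, 1)).2 ≠ 0 := by
      intro h3
      have := congrArg Prod.snd (hinj (0, 1) (Prod.ext h2 h3))
      exact one_ne_zero this
    have h4 : ∀ k : ZMod 2, k ≠ 0 → k = 1 := by decide
    exact Prod.ext h2 (h4 _ h3)
  have hk : ∀ k : ZMod 2, a (0, k) = (0, k) := by
    intro k
    have : k = 0 ∨ k = 1 := by revert k; decide
    rcases this with rfl | rfl
    · exact map_zero a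
    · exact hone
  refine ⟨f 1, ?_, fun x => ?_⟩
  · intro h0
    have := congrArg Prod.fst (hinj (1, 0) (Prod.ext (by rw [hlin, h0]; simp) (hsnd 1)))
    exact one_ne_zero this
  · have hx : x = (x.1, 0) + (0, x.2) := by ext <;> simp
    conv_lhs => rw [hx]
    rw [map_add, hk]
    ext
    · simp [hlin]
    · simp [hsnd]

theorem pairing_add_left (x y : X) (s : ℝ) (l : ZMod 2) :
    pairing (x + y) s l = pairing x s l * pairing y s l := by
  have h : ∀ k k' l : ZMod 2,
      Even ((k + k').val * l.val) ↔ Even (k.val * l.val + k'.val * l.val) := by decide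
  have h' : (-1 : ℂ) ^ ((x.2 + y.2).val * l.val) =
      (-1 : ℂ) ^ (x.2.val * l.val) * (-1 : ℂ) ^ (y.2.val * l.val) := by
    rw [← pow_add]
    exact neg_one_pow_congr (h _ _ _)
  rw [pairing, pairing, pairing, Prod.snd_add, h', Prod.fst_add, Complex.ofReal_add, mul_add,
    add_mul, Complex.exp_add]
  ring

theorem pairing_zero_left (s : ℝ) (l : ZMod 2) : pairing 0 s l = 1 := by
  simp [pairing]

theorem pairing_sum_left {ι : Type*} (S : Finset ι) (x : ι → X) (s : ℝ) (l : ZMod 2) :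
    pairing (∑ j ∈ S, x j) s l = ∏ j ∈ S, pairing (x j) s l := by
  classical
  induction S using Finset.induction_on with
  | empty => simp [pairing_zero_left]
  | insert j S hj ih => rw [Finset.sum_insert hj, Finset.prod_insert hj, pairing_add_left, ih]

theorem pairing_neg_left_zero (x : X) (t : ℝ) : pairing (-x) t 0 = pairing x (-t) 0 := by
  simp [pairing]

theorem pairing_dilation_mul (α β : ℝ) (x : X) (s t : ℝ) (l : ZMod 2) :
    pairing (α * x.1, x.2) s l * pairing (β * x.1, x.2) t 0 = pairing x (α * s + β * t) l := by
  simp only [pairing, ZMod.val_zero, mul_zero, pow_zero, mul_one]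
  rw [mul_right_comm, ← Complex.exp_add]
  push_cast
  ring_nf

/-- Conditional symmetry means that `(L₁, L₂)` and `(L₁, -L₂)` have the same distribution. -/
theorem map_prodMk_neg_eq_of_condSymmetric {Ω : Type*} [MeasurableSpace Ω] {P : Measure Ω}
    [IsFiniteMeasure P] {L₁ L₂ : Ω → X} (h₁ : Measurable L₁) (h₂ : Measurable L₂)
    (h : CondSymmetric P L₂ L₁) :
    P.map (fun ω => (L₁ ω, -L₂ ω)) = P.map (fun ω => (L₁ ω, L₂ ω)) := by
  have hneg : Measurable fun z : X => -z := measurable_neg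
  have hk : (condDistrib L₂ L₁ P).map (fun z => -z) =ᵐ[P.map L₁] condDistrib L₂ L₁ P := by
    filter_upwards [h] with x hx
    rw [Kernel.map_apply _ hneg, hx]
  have h1 := Measure.compProd_congr hk
  rw [Measure.compProd_map hneg, compProd_map_condDistrib h₂.aemeasurable,
    Measure.map_map (by fun_prop) (by fun_prop)] at h1
  exact h1

/-- Heyde's functional equation. The second coordinates of `L₂` are paired with the trivial character
only, because addition and subtraction coincide in `ℤ(2)`. -/
theorem charFn_functional_equation {n : ℕ} {a b : Fin n → (X ≃ₜ+ X)} {Ω : Type*}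
    [MeasurableSpace Ω] {P : Measure Ω} [IsProbabilityMeasure P] {ξ : Fin n → Ω → X}
    (hξ : ∀ j, Measurable (ξ j)) (hindep : iIndepFun ξ P) {μ : Fin n → Measure X}
    (hμ : ∀ j, μ j = P.map (ξ j))
    (hsymm : CondSymmetric P (fun ω => ∑ j, b j (ξ j ω)) (fun ω => ∑ j, a j (ξ j ω)))
    {α β : Fin n → ℝ} (ha : ∀ j x, a j x = (α j * x.1, x.2))
    (hb : ∀ j x, b j x = (β j * x.1, x.2)) (s t : ℝ) (l : ZMod 2) :
    ∏ j, charFn (μ j) (α j * s + β j * t) l = ∏ j, charFn (μ j) (α j * s - β j * t) l := by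
  set L₁ : Ω → X := fun ω => ∑ j, a j (ξ j ω) with hL₁
  set L₂ : Ω → X := fun ω => ∑ j, b j (ξ j ω) with hL₂
  have h₁ : Measurable L₁ := Finset.measurable_sum _ fun j _ =>
    (a j).continuous.measurable.comp (hξ j)
  have h₂ : Measurable L₂ := Finset.measurable_sum _ fun j _ =>
    (b j).continuous.measurable.comp (hξ j)
  have hlaw := map_prodMk_neg_eq_of_condSymmetric h₁ h₂ hsymm
  have hexp : ∀ t : ℝ, ∏ j, charFn (μ j) (α j * s + β j * t) l =
      ∫ ω, pairing (L₁ ω) s l * pairing (L₂ ω) t 0 ∂P := by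
    intro t
    have h1 : ∀ ω, pairing (L₁ ω) s l * pairing (L₂ ω) t 0 =
        ∏ j, pairing (ξ j ω) (α j * s + β j * t) l := by
      intro ω
      rw [hL₁, hL₂]
      simp only
      rw [pairing_sum_left, pairing_sum_left, ← Finset.prod_mul_distrib]
      refine Finset.prod_congr rfl fun j _ => ?_
      rw [ha, hb, pairing_dilation_mul]
    simp_rw [h1]
    rw [hindep.integral_fun_prod_comp (f := fun j x => pairing x (α j * s + β j * t) l)
      (fun j => (hξ j).aemeasurable) fun j => (measurable_pairing _ _).aestronglyMeasurable]
    refine Finset.prod_congr rfl fun j _ => ?_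
    rw [charFn, hμ, integral_map (hξ j).aemeasurable
      (measurable_pairing _ _).aestronglyMeasurable]
  have hm : Measurable fun z : X × X => pairing z.1 s l * pairing z.2 t 0 :=
    ((measurable_pairing s l).comp measurable_fst).mul
      ((measurable_pairing t 0).comp measurable_snd)
  have hint := congrArg (fun Q : Measure (X × X) => ∫ z, pairing z.1 s l * pairing z.2 t 0 ∂Q) hlaw
  rw [integral_map (by fun_prop) hm.aestronglyMeasurable,
    integral_map (by fun_prop) hm.aestronglyMeasurable] at hint
  simp only [pairing_neg_left_zero] at hint
  rw [← hexp, ← hexp] at hint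
  rw [← hint]
  refine Finset.prod_congr rfl fun j _ => ?_
  congr 1
  ring

/-! ### Distributions with equal slices -/

theorem eq_slice_map_add_slice_map (μ : Measure X) :
    μ = (slice μ 0).map (fun t => (t, (0 : ZMod 2))) +
      (slice μ 1).map (fun t => (t, (1 : ZMod 2))) := by
  have h : ∀ k : ZMod 2, (slice μ k).map (fun t => (t, k)) = μ.restrict (Prod.snd ⁻¹' {k}) := by
    intro k
    rw [slice, Measure.map_map (by fun_prop) measurable_fst]
    conv_rhs => rw [← Measure.map_id (μ := μ.restrict (Prod.snd ⁻¹' {k}))]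
    refine Measure.map_congr ?_
    filter_upwards [ae_restrict_mem (measurable_snd (measurableSet_singleton k))] with x hx
    have : x.2 = k := hx
    simp [← this]
  rw [h, h, restrict_snd_add_restrict_snd]

theorem embReal_conv_embZ2 (γ : Measure ℝ) [SFinite γ] :
    (embReal γ).conv (embZ2 haarZ2) = γ.prod haarZ2 := by
  rw [Measure.conv, embReal, embZ2, Measure.map_prod_map _ _ (by fun_prop) (by fun_prop),
    Measure.map_map (by fun_prop) (by fun_prop)]
  conv_rhs => rw [← Measure.map_id (μ := γ.prod haarZ2)]
  congr 1
  ext x <;> simp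

theorem prod_haarZ2 (γ : Measure ℝ) [SFinite γ] :
    γ.prod haarZ2 = (2 : ENNReal)⁻¹ • (γ.map (fun t => (t, (0 : ZMod 2))) +
      γ.map (fun t => (t, (1 : ZMod 2)))) := by
  rw [haarZ2, Measure.prod_smul_right, Measure.prod_add, Measure.prod_dirac, Measure.prod_dirac]

/-- If `charFn μ · 1` vanishes, both slices of `μ` equal half of the real marginal. -/
theorem eq_conv_haarZ2_of_charFn_one_eq_zero (μ : Measure X) [IsFiniteMeasure μ]
    (h : ∀ s, charFn μ s 1 = 0) :
    μ = (embReal (μ.map Prod.fst)).conv (embZ2 haarZ2) := by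
  have hs : slice μ 0 = slice μ 1 := by
    refine Measure.ext_of_charFun (funext fun s => ?_)
    have := h s
    rwa [charFn_one_right, sub_eq_zero] at this
  have hγ : μ.map Prod.fst = (2 : ENNReal) • slice μ 0 := by
    rw [← slice_add_slice, ← hs, two_smul]
  rw [embReal_conv_embZ2, prod_haarZ2, hγ, Measure.map_smul, Measure.map_smul, ← smul_add,
    smul_smul, ENNReal.inv_mul_cancel two_ne_zero ENNReal.ofNat_ne_top, one_smul]
  conv_lhs => rw [eq_slice_map_add_slice_map μ, ← hs]

theorem charFn_conv_haarZ2_one (γ : Measure ℝ) [IsFiniteMeasure γ] (s : ℝ) :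
    charFn ((embReal γ).conv (embZ2 haarZ2)) s 1 = 0 := by
  rw [embReal_conv_embZ2, charFn, integral_prod _ (integrable_pairing _ s 1)]
  have : ∀ t : ℝ, ∫ k, pairing (t, k) s 1 ∂haarZ2 = 0 := by
    intro t
    have hi : ∀ k₀ : ZMod 2,
        Integrable (fun k : ZMod 2 => pairing (t, k) s 1) (Measure.dirac k₀) := fun k₀ =>
      Integrable.of_finite
    rw [haarZ2, integral_smul_measure, integral_add_measure (hi 0) (hi 1), integral_dirac,
      integral_dirac]
    simp [pairing, ZMod.val_one]
  simp [this]

/-! ### Gaussian marginals and the entire extension of the twisted transform -/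

/-- The entire extension, rotated by `i`, of `s ↦ charFn μ s 1`: the difference of the complex
moment generating functions of the two slices. -/
noncomputable def twistedMGF (μ : Measure X) (z : ℂ) : ℂ :=
  complexMGF id (slice μ 0) z - complexMGF id (slice μ 1) z

theorem twistedMGF_mul_I (μ : Measure X) [IsFiniteMeasure μ] (s : ℝ) :
    twistedMGF μ (s * Complex.I) = charFn μ s 1 := by
  rw [twistedMGF, complexMGF_id_mul_I, complexMGF_id_mul_I, charFn_one_right]

theorem integrable_exp_slice {μ : Measure X} (h : InLambda μ) (k : ZMod 2) (r : ℝ) :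
    Integrable (fun x => Real.exp (r * x)) (slice μ k) := by
  obtain ⟨m, v, hmv⟩ := h
  refine (integrable_exp_mul_gaussianReal (μ := m) (v := v) r).mono_measure ?_
  rw [← hmv, slice]
  exact Measure.map_mono Measure.restrict_le_self measurable_fst

theorem differentiable_twistedMGF {μ : Measure X} (h : InLambda μ) :
    Differentiable ℂ (twistedMGF μ) :=
  (differentiable_complexMGF (integrable_exp_slice h 0)).sub
    (differentiable_complexMGF (integrable_exp_slice h 1))

theorem exists_norm_twistedMGF_le {μ : Measure X} (h : InLambda μ) :
    ∃ C : ℝ, ∀ z, ‖twistedMGF μ z‖ ≤ Real.exp (C * (1 + ‖z‖) ^ 2) := by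
  have h' := h
  obtain ⟨m, v, hmv⟩ := h'
  refine ⟨|m| + v, fun z => ?_⟩
  set x := z.re with hx
  have h1 : ‖twistedMGF μ z‖ ≤ Real.exp (m * x + v * x ^ 2 / 2) := by
    refine (norm_sub_le _ _).trans ?_
    refine (add_le_add norm_complexMGF_le_mgf norm_complexMGF_le_mgf).trans ?_
    have e := mgf_add_measure (X := id) (integrable_exp_slice h 0 x) (integrable_exp_slice h 1 x)
    rw [slice_add_slice] at e
    rw [← e, hmv, mgf_gaussianReal (μ := m) (v := v) (by simp)]
  refine h1.trans (Real.exp_le_exp.2 ?_)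
  have hxz : |x| ≤ ‖z‖ := Complex.abs_re_le_norm z
  have h2 : m * x ≤ |m| * ‖z‖ := by
    refine (le_abs_self _).trans ?_
    rw [abs_mul]
    gcongr
  have h3 : x ^ 2 ≤ ‖z‖ ^ 2 := by
    rw [← sq_abs]; gcongr
  have hz := norm_nonneg z
  have hv : (0 : ℝ) ≤ v := v.2
  have h4 : (v : ℝ) * x ^ 2 / 2 ≤ v * (1 + ‖z‖) ^ 2 := by
    have : x ^ 2 / 2 ≤ (1 + ‖z‖) ^ 2 := by nlinarith
    rw [mul_div_assoc]
    gcongr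
  have h5 : |m| * ‖z‖ ≤ |m| * (1 + ‖z‖) ^ 2 := by
    have : ‖z‖ ≤ (1 + ‖z‖) ^ 2 := by nlinarith
    gcongr
  linarith

/-- A zero-free `twistedMGF` is the exponential of a quadratic polynomial, real on the real axis and
bounded on the imaginary axis. -/
theorem inTheta_of_twistedMGF_ne_zero {μ : Measure X} [IsProbabilityMeasure μ] (h : InLambda μ)
    (h0 : ∀ z, twistedMGF μ z ≠ 0) : InTheta μ := by
  obtain ⟨C, hC⟩ := exists_norm_twistedMGF_le h
  obtain ⟨q, hq, hqe⟩ := exists_eq_exp_polynomial (differentiable_twistedMGF h) h0 hC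
  obtain ⟨κ, σ', β', hκ, hσ', -, hform⟩ := exists_gaussian_form hq hqe
    (fun x => by rw [twistedMGF, map_sub, conj_complexMGF_ofReal, conj_complexMGF_ofReal])
    (B := 1) (fun s => by
      rw [twistedMGF_mul_I]
      have := norm_integral_le_of_norm_le_const (μ := μ)
        (Eventually.of_forall fun x => (norm_pairing x s 1).le)
      simpa [charFn] using this)
  obtain ⟨m, v, hmv⟩ := h
  exact inTheta_of_gaussian_forms hmv hκ hσ' fun s => by rw [← twistedMGF_mul_I, hform]

theorem charFn_zero_ne_zero {μ : Measure X} (h : InLambda μ) (s : ℝ) : charFn μ s 0 ≠ 0 := by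
  obtain ⟨m, v, hmv⟩ := h
  rw [charFn_zero_right, hmv, charFun_gaussianReal]
  exact Complex.exp_ne_zero _

theorem isGaussianLaw_of_map_mul {ν : Measure ℝ} {α : ℝ} (hα : α ≠ 0)
    (h : IsGaussianLaw (ν.map (α * ·))) : IsGaussianLaw ν := by
  obtain ⟨m, v, hmv⟩ := h
  refine ⟨α⁻¹ * m, .mk (α⁻¹ ^ 2) (sq_nonneg _) * v, ?_⟩
  rw [← gaussianReal_map_const_mul, ← hmv, Measure.map_map (by fun_prop) (by fun_prop)]
  have : ((α⁻¹ * ·) ∘ (α * ·) : ℝ → ℝ) = id := by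
    ext t
    simp [hα]
  rw [this, Measure.map_id]

end HeydeRZ2

theorem theorem2p1 (n : ℕ) (hn : 2 ≤ n)
    (a b : Fin n → (HeydeRZ2.X ≃ₜ+ HeydeRZ2.X))
    -- the endomorphism `b_i a_i⁻¹ + b_j a_j⁻¹` of `X` is nonzero
    (hab : ∀ i j : Fin n,
      (fun x : HeydeRZ2.X => b i ((a i).symm x) + b j ((a j).symm x)) ≠ fun _ => 0)
    {Ω : Type*} [MeasurableSpace Ω] (P : Measure Ω) [IsProbabilityMeasure P]
    (ξ : Fin n → Ω → HeydeRZ2.X) (hξ : ∀ j, Measurable (ξ j))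
    (hindep : iIndepFun ξ P)
    (μ : Fin n → Measure HeydeRZ2.X) (hμ : ∀ j, μ j = P.map (ξ j))
    (hsymm : HeydeRZ2.CondSymmetric P
      (fun ω => ∑ j, b j (ξ j ω)) (fun ω => ∑ j, a j (ξ j ω))) :
    Xor
      ((∀ j, HeydeRZ2.InLambda (μ j)) ∧
        ∃ j, ∃ γ : Measure ℝ, HeydeRZ2.IsGaussianLaw γ ∧
          μ j = (HeydeRZ2.embReal γ).conv (HeydeRZ2.embZ2 HeydeRZ2.haarZ2))
      (∀ j, HeydeRZ2.InTheta (μ j) ∧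
        ∀ (s : ℝ) (l : ZMod 2), HeydeRZ2.charFn (μ j) s l ≠ 0) := by
  open HeydeRZ2 in
  choose α hα ha using fun j => exists_automorphism_apply (a j)
  choose β hβ hb using fun j => exists_automorphism_apply (b j)
  have hprob : ∀ j, IsProbabilityMeasure (μ j) := fun j => by
    rw [hμ]
    exact Measure.isProbabilityMeasure_map (hξ j).aemeasurable
  set c : Fin n → ℝ := fun j => β j / α j with hc
  have hc0 : ∀ i j, c i + c j ≠ 0 := by
    intro i j h
    refine hab i j (funext fun x => ?_)
    have hsymm_apply : ∀ j, (a j).symm x = (x.1 / α j, x.2) := by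
      intro j
      rw [ContinuousAddEquiv.symm_apply_eq, ha]
      ext
      · simp [mul_div_cancel₀ _ (hα j)]
      · rfl
    have htwo : ∀ k : ZMod 2, k + k = 0 := by decide
    rw [hsymm_apply, hsymm_apply, hb, hb]
    ext
    · simp only [Prod.mk_add_mk, Prod.fst_zero]
      have : β i * (x.1 / α i) + β j * (x.1 / α j) = (c i + c j) * x.1 := by
        simp only [hc]; ring
      rw [this, h, zero_mul]
    · simp [htwo]
  have heq := charFn_functional_equation hξ hindep hμ hsymm ha hb
  have hlin : ∀ j (s t : ℝ), α j * (s + c j * t) = α j * s + β j * t ∧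
      α j * (s - c j * t) = α j * s - β j * t := by
    intro j s t
    have := hα j
    constructor <;> simp only [hc] <;> field_simp
  have hΛ : ∀ j, InLambda (μ j) := by
    have hp : ∀ j, IsProbabilityMeasure (((μ j).map Prod.fst).map (α j * ·)) := fun j => by
      have := Measure.isProbabilityMeasure_map (μ := μ j) measurable_fst.aemeasurable
      exact Measure.isProbabilityMeasure_map (by fun_prop)
    intro j
    refine isGaussianLaw_of_map_mul (hα j)
      (isGaussianLaw_of_heyde (ρ := fun j => ((μ j).map Prod.fst).map (α j * ·)) hc0
        (fun s t => ?_) j)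
    have := heq s t 0
    simpa only [charFn_zero_right, charFun_map_mul, hlin] using this
  by_cases hz : ∃ j, ∀ s, charFn (μ j) s 1 = 0
  · obtain ⟨j, hj⟩ := hz
    refine Or.inl ⟨⟨hΛ, j, (μ j).map Prod.fst, hΛ j,
      eq_conv_haarZ2_of_charFn_one_eq_zero (μ j) hj⟩, fun h => (h j).2 0 1 (hj 0)⟩
  · push Not at hz
    -- `z ↦ twistedMGF (μ j) (α j * z * I)` extends `s ↦ charFn (μ j) (α j * s) 1`
    have hne : ∀ j z, twistedMGF (μ j) z ≠ 0 := by
      intro j z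
      have := entire_heyde_ne_zero (H := fun j z => twistedMGF (μ j) (α j * z * Complex.I))
        (c := c)
        (fun j => (differentiable_twistedMGF (hΛ j)).comp (by fun_prop))
        (fun j => by
          obtain ⟨s, hs⟩ := hz j
          refine ⟨((s / α j : ℝ) : ℂ), ?_⟩
          rwa [← Complex.ofReal_mul, mul_div_cancel₀ _ (hα j), twistedMGF_mul_I])
        hc0
        (fun s t => by
          have h := heq s t 1
          simp only [← twistedMGF_mul_I, ← hlin] at h
          push_cast at h
          exact h) j (-(z * Complex.I) / α j)
      have hαj : (α j : ℂ) ≠ 0 := by exact_mod_cast hα j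
      have e : (α j : ℂ) * (-(z * Complex.I) / α j) * Complex.I = z := by
        rw [mul_div_cancel₀ _ hαj]
        linear_combination (-z) * Complex.I_sq
      simpa only [e] using this
    refine Or.inr ⟨fun j => ⟨inTheta_of_twistedMGF_ne_zero (hΛ j) (hne j), fun s l => ?_⟩, ?_⟩
    · have : l = 0 ∨ l = 1 := by revert l; decide
      rcases this with rfl | rfl
      · exact charFn_zero_ne_zero (hΛ j) s
      · rw [← twistedMGF_mul_I]
        exact hne j _
    · rintro ⟨-, j, γ, ⟨m, v, rfl⟩, hj⟩
      obtain ⟨s, hs⟩ := hz j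
      rw [hj, charFn_conv_haarZ2_one] at hs
      exact hs rfl
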